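/- Let $q$ be a power of a prime number. A Weil $q$-number is an algebraic integer $\pi$ in a field of characteristic zero such that $|\iota(\pi)|=q^{1/2}$ for every embedding $\iota:\mathbb{Q}(\pi)\hookrightarrow\mathbb{C}$. Two Weil $q$-numbers $\pi,\pi'$ are conjugate if there is an isomorphism $\mathbb{Q}(\pi)\simeq\mathbb{Q}(\pi')$ carrying $\pi$ to $\pi'$; let $W_q$ be the set of conjugacy classes. For a finite subset $w\subseteq W_q$ with representatives $\pi_1,\dots,\pi_r$, let $R_w$ be the quotient of $\mathbb{Z}[F,V]/(FV-q)$ by the kernel of the ring homomorphism $$\mathbb{Z}[F,V]/(FV-q)\to\prod_{i=1}^r\mathbb{Q}(\pi_i),\qquad F\mapsto(\pi_i)_i,\quad V\mapsto(q/\pi_i)_i.$$ Say that $w$ has even degree if $\deg(w)=\sum_{\pi\in w}[\mathbb{Q}(\pi):\mathbb{Q}]$ is even (equivalently, $w$ contains both or neither of the rational Weil $q$-numbers $\pm q^{1/2}$, which exist only if $q$ is a square). Let $P_\pi(x)=x^{2d}+a_{2d-1}x^{2d-1}+\dots+a_0\in\mathbb{Z}[x]$ be the minimal polynomial of $\pi$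 over $\mathbb{Q}$ if $\pi$ is not real. Define $h_\pi\in\mathbb{Z}[F^{1/2},V^{1/2}]$ by $$h_\pi(F,V)=F^d+a_{2d-1}F^{d-1}+\dots+a_{d+1}F+a_d+a_{d+1}V+\dots+a_{2d-1}V^{d-1}+V^d$$ if $\pi$ is not real, $h_\pi=F-V$ if $\pi$ is real but not rational, and $h_\pi=F^{1/2}\mp V^{1/2}$ if $\pi=\pm q^{1/2}$ is rational. Put $h_w=\prod_{\pi\in w}h_\pi$. Theorem. Let $w\subseteq W_q$ be a finite set of even degree. Then: (a) $h_w$ lies in $\mathbb{Z}[F,V]$ and $R_w=\mathbb{Z}[F,V]/(FV-q,\,h_w(F,V))$, as quotients of $\mathbb{Z}[F,V]$. (b) If $w$ is non-empty, the ring $R_w$ has Krull dimension $1$ and is a complete intersection, i.e. isomorphic to the quotient of a regular ring by an ideal generated by a regular sequence. In particular it is a Gorenstein ring, i.e. it is Noetherian and each of its localizations at a prime ideal has finite injective dimension as a module over itself. -/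

import Mathlib

open scoped IntermediateField

noncomputable section

/-! ### Weil numbers and their conjugacy classes -/

/-- The element `π` of a field of characteristic zero is a Weil `q`-number: it is an algebraic
integer, and `|ι(π)| = q^{1/2}` for every embedding `ι : ℚ(π) ↪ ℂ`. -/
def IsWeilNumber (q : ℕ) {K : Type*} [Field K] [CharZero K] (π : K) : Prop :=
  IsIntegral ℤ π ∧
    ∀ ι : ℚ⟮π⟯ →+* ℂ, ‖ι (IntermediateField.AdjoinSimple.gen ℚ π)‖ = Real.sqrt q

/-- Two elements are conjugate if there is an isomorphism `ℚ(π) ≃ ℚ(π')` carrying `π` to `π'`. -/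
def AreConjugate {K L : Type*} [Field K] [CharZero K] [Field L] [CharZero L]
    (π : K) (π' : L) : Prop :=
  ∃ e : ℚ⟮π⟯ ≃+* ℚ⟮π'⟯,
    e (IntermediateField.AdjoinSimple.gen ℚ π) = IntermediateField.AdjoinSimple.gen ℚ π'

/-- Conjugacy of complex Weil `q`-numbers. -/
def weilSetoid (q : ℕ) : Setoid {π : ℂ // IsWeilNumber q π} where
  r π π' := AreConjugate π.1 π'.1
  iseqv :=
    { refl := fun _ => ⟨RingEquiv.refl _, rfl⟩
      symm := by
        rintro _ _ ⟨e, he⟩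
        exact ⟨e.symm, by rw [← he, RingEquiv.symm_apply_apply]⟩
      trans := by
        rintro _ _ _ ⟨e, he⟩ ⟨f, hf⟩
        exact ⟨e.trans f, by rw [RingEquiv.trans_apply, he, hf]⟩ }

/-- The set `W_q` of conjugacy classes of Weil `q`-numbers. Every Weil `q`-number, in whatever field
of characteristic zero it lies, is conjugate to one in `ℂ`, so complex ones give all classes. -/
def WeilClass (q : ℕ) : Type := Quotient (weilSetoid q)

/-- The complex Weil `q`-number that is chosen to represent a conjugacy class. -/
def WeilClass.rep {q : ℕ} (c : WeilClass q) : ℂ := (Quotient.out c).1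

theorem WeilClass.isWeilNumber_rep {q : ℕ} (c : WeilClass q) : IsWeilNumber q c.rep :=
  (Quotient.out c).2

/-- The number field `ℚ(π)` of a conjugacy class. -/
abbrev WeilClass.field {q : ℕ} (c : WeilClass q) : Type := ℚ⟮c.rep⟯

/-- The element `π` of `ℚ(π)`. -/
def WeilClass.gen {q : ℕ} (c : WeilClass q) : c.field :=
  IntermediateField.AdjoinSimple.gen ℚ c.rep

theorem WeilClass.gen_mul_div {q : ℕ} (c : WeilClass q) :
    c.gen * ((q : c.field) / c.gen) = (q : c.field) := by
  by_cases h : c.gen = 0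
  · have h1 := c.isWeilNumber_rep.2 (algebraMap c.field ℂ)
    have h2 : IntermediateField.AdjoinSimple.gen ℚ c.rep = 0 := h
    rw [h2, map_zero, norm_zero, eq_comm, Real.sqrt_eq_zero (Nat.cast_nonneg q)] at h1
    have h3 : q = 0 := by exact_mod_cast h1
    have h4 : (q : c.field) = 0 := by exact_mod_cast h3
    rw [h, zero_mul, h4]
  · exact mul_div_cancel₀ _ h

/-- The degree of a finite set `w` of classes: the sum of the degrees `[ℚ(π) : ℚ]`. -/
def weilDegree {q : ℕ} (w : Finset (WeilClass q)) : ℕ :=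
  ∑ c ∈ w, Module.finrank ℚ c.field

/-! ### Minimal central orders

The polynomial ring `ℤ[F, V]` is `MvPolynomial (Fin 2) ℤ`, with `F = X 0` and `V = X 1`. -/

/-- The element `FV - q` of `ℤ[F, V]`. -/
def relFV (q : ℕ) : MvPolynomial (Fin 2) ℤ :=
  MvPolynomial.X 0 * MvPolynomial.X 1 - MvPolynomial.C (q : ℤ)

/-- The ring `ℤ[F, V]/(FV - q)`. -/
abbrev FVRing (q : ℕ) : Type := MvPolynomial (Fin 2) ℤ ⧸ Ideal.span {relFV q}

/-- The homomorphism from `ℤ[F, V]` to the product of the fields `ℚ(π)`, `π ∈ w`, that sends `F` to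
the family of the `π` and `V` to the family of the `q/π`. -/
def polyToProd {q : ℕ} (w : Finset (WeilClass q)) :
    MvPolynomial (Fin 2) ℤ →+* (∀ c : w, c.1.field) :=
  MvPolynomial.eval₂Hom (Int.castRingHom (∀ c : w, c.1.field))
    ![fun c => c.1.gen, fun c => (q : c.1.field) / c.1.gen]

theorem polyToProd_relFV {q : ℕ} (w : Finset (WeilClass q)) : polyToProd w (relFV q) = 0 := by
  funext c
  simp [polyToProd, relFV, WeilClass.gen_mul_div]

/-- The homomorphism `ℤ[F, V]/(FV - q) → ∏ ℚ(π)`, `F ↦ (π)`, `V ↦ (q/π)`. -/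
def toProd {q : ℕ} (w : Finset (WeilClass q)) : FVRing q →+* (∀ c : w, c.1.field) :=
  Ideal.Quotient.lift (Ideal.span {relFV q}) (polyToProd w) (by
    intro a ha
    have h : Ideal.span {relFV q} ≤ RingHom.ker (polyToProd w) := by
      rw [Ideal.span_le, Set.singleton_subset_iff]
      exact polyToProd_relFV w
    exact h ha)

/-- The minimal central order `R_w`: the quotient of `ℤ[F, V]/(FV - q)` by the kernel of its
homomorphism to the product of the fields `ℚ(π)`, `π ∈ w`. -/
abbrev MinimalCentralOrder {q : ℕ} (w : Finset (WeilClass q)) : Type :=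
  FVRing q ⧸ RingHom.ker (toProd w)

/-- The natural surjection from `ℤ[F, V]` onto `R_w`; it sends `F` to `F_w` and `V` to `V_w`. -/
def toMinimalCentralOrder {q : ℕ} (w : Finset (WeilClass q)) :
    MvPolynomial (Fin 2) ℤ →+* MinimalCentralOrder w :=
  (Ideal.Quotient.mk (RingHom.ker (toProd w))).comp (Ideal.Quotient.mk (Ideal.span {relFV q}))

/-! ### The symmetric polynomial -/

/-- The normalized minimal polynomial `P_π ∈ ℤ[x]` of a conjugacy class. -/
def WeilClass.minimalPolynomial {q : ℕ} (c : WeilClass q) : Polynomial ℤ := minpoly ℤ c.rep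

/-- For `P = x^{2d} + a_{2d-1} x^{2d-1} + ⋯ + a_0`, the polynomial
`F^d + a_{2d-1} F^{d-1} + ⋯ + a_{d+1} F + a_d + a_{d+1} V + ⋯ + a_{2d-1} V^{d-1} + V^d`. -/
def symmetrization (P : Polynomial ℤ) : MvPolynomial (Fin 2) ℤ :=
  MvPolynomial.C (P.coeff (P.natDegree / 2)) +
    ∑ r ∈ Finset.Icc 1 (P.natDegree / 2),
      MvPolynomial.C (P.coeff (P.natDegree / 2 + r)) *
        (MvPolynomial.X 0 ^ r + MvPolynomial.X 1 ^ r)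

open Classical in
/-- The polynomial `h_π`, as an element of `ℤ[F^{1/2}, V^{1/2}]`: here the two variables stand for
`F^{1/2}` and `V^{1/2}`, and `ℤ[F, V]` is embedded by `MvPolynomial.expand 2`, that is by
`F ↦ (F^{1/2})²`, `V ↦ (V^{1/2})²`. The cases are: `π` not real; `π` real and not rational
(`h_π = F - V`); `π` a positive integer (`h_π = F^{1/2} - V^{1/2}`); `π` a negative integer
(`h_π = F^{1/2} + V^{1/2}`). -/
def WeilClass.symmetricPolynomial {q : ℕ} (c : WeilClass q) : MvPolynomial (Fin 2) ℤ :=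
  if c.rep.im ≠ 0 then MvPolynomial.expand 2 (symmetrization c.minimalPolynomial)
  else if c.rep ∉ Set.range (algebraMap ℚ ℂ) then
    MvPolynomial.expand 2 (MvPolynomial.X 0 - MvPolynomial.X 1)
  else if 0 < c.rep.re then MvPolynomial.X 0 - MvPolynomial.X 1
  else MvPolynomial.X 0 + MvPolynomial.X 1

/-- The polynomial `h_w = ∏ h_π` of a finite set `w`, as an element of `ℤ[F^{1/2}, V^{1/2}]`. -/
def symmetricPolynomial {q : ℕ} (w : Finset (WeilClass q)) : MvPolynomial (Fin 2) ℤ :=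
  ∏ c ∈ w, c.symmetricPolynomial

end

/-! ### Complete intersections and Gorenstein rings -/

/-- A ring is a complete intersection if it is the quotient of a regular (Noetherian) ring by an
ideal generated by a regular sequence. The notion is the global one: it implies that every
localization at a prime, and its completion, are complete intersections too. -/
def IsCompleteIntersectionRing.{u} (R : Type u) [CommRing R] : Prop :=
  ∃ (S : Type u) (_ : CommRing S) (_ : IsRegularRing S) (rs : List S),
    RingTheory.Sequence.IsRegular S rs ∧ Nonempty (R ≃+* S ⧸ Ideal.ofList rs)

/-- A Noetherian local ring is Gorenstein if it has finite injective dimension over itself. -/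
def IsGorensteinLocalRing (R : Type*) [CommRing R] : Prop :=
  IsNoetherianRing R ∧ IsLocalRing R ∧
    ∃ n : ℕ, CategoryTheory.HasInjectiveDimensionLE (ModuleCat.of R R) n

/-- A Noetherian ring is Gorenstein if its localization at every prime ideal is a Gorenstein local
ring. -/
def IsGorensteinRing (R : Type*) [CommRing R] : Prop :=
  IsNoetherianRing R ∧
    ∀ (P : Ideal R) [P.IsPrime], IsGorensteinLocalRing (Localization.AtPrime P)

/-!
For every `π ∈ w` the polynomial `h_π` vanishes at `(π, q/π)`. If `π` is not real, then
`h_π(F, q/F) = F^{-d} P_π(F)`, by the functional equation `x^{2d} P_π(q/x) = q^d P_π(x)`. That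
holds because `q/π` is the complex conjugate of `π`, so that both sides are multiples of `P_π`; the
constant, and the parity of the degree, are found by evaluating at `x = ±√q`, where `P_π` does not
vanish (`even_natDegree_minpoly`, `minpoly_coeff_sub`). If `π` is real, then `π² = q`. A set `w` of
even degree contains both rational Weil numbers or neither, and
`(F^{1/2} - V^{1/2})(F^{1/2} + V^{1/2}) = F - V`, so `h_w` lies in `ℤ[F, V]`.

Let `2D = deg(w)`. In any ring in which `FV = q`, the element `h_w` is `F^D ± V^D` up to lower
powers of `F` and `V`: this shape, called balanced here, is stable under products
(`IsBalanced.mul`). Hence `ℤ[F, V]/(FV - q, h_w)` is generated as an abelian group by the `2D`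
elements `F^i`, `0 ≤ i < D`, and `V^j`, `1 ≤ j ≤ D` (`span_powerFamily_eq_top`). It maps onto
`R_w`, in which `1, F, …, F^{2D-1}` are linearly independent, since an integral polynomial of
degree less than `2D` cannot vanish at all `π ∈ w`. Comparing ranks, the map is an isomorphism and
the `2D` elements are a basis of `R_w` (`ker_eq_span_of_linearIndependent`).

So, for non-empty `w`, `R_w` is finite and faithful over `ℤ` and has dimension `1`. The sequence
`FV - q`, `h_w` is regular in `ℤ[F, V]`, because `FV - q` is prime and does not divide `h_w`:
otherwise `ℤ[F, V]/(FV - q)` would be finite over `ℤ`.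

For the Gorenstein property let `τ : R_w → ℤ` be the coordinate at `V^D`. In the basis above the
pairing `(x, y) ↦ τ(xy)` is antitriangular with diagonal blocks signed permutation matrices, so
`R_w ≅ Hom(R_w, ℤ)` (`exists_eq_functional_mul`). As `R_w` is free over `ℤ`, this gives the
resolution `0 → R_w → Hom(R_w, ℚ) → Hom(R_w, ℚ/ℤ) → 0` of length one, in which the coinduced
modules are injective because `ℚ` and `ℚ/ℤ` are divisible. Injective dimension does not increase
under localization of a Noetherian ring.
-/

/-! ### Balanced elements -/

section Balanced

variable {A : Type*} [CommRing A]

/-- The additive group spanned by the powers `F^i` and `V^i` with `i < n`. -/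
def lowSpan (F V : A) (n : ℕ) : Submodule ℤ A :=
  Submodule.span ℤ ({x | ∃ i < n, x = F ^ i} ∪ {x | ∃ i < n, x = V ^ i})

theorem pow_left_mem_lowSpan {F V : A} {i n : ℕ} (h : i < n) : F ^ i ∈ lowSpan F V n :=
  Submodule.subset_span (Or.inl ⟨i, h, rfl⟩)

theorem pow_right_mem_lowSpan {F V : A} {i n : ℕ} (h : i < n) : V ^ i ∈ lowSpan F V n :=
  Submodule.subset_span (Or.inr ⟨i, h, rfl⟩)

theorem lowSpan_mono {F V : A} {m n : ℕ} (h : m ≤ n) : lowSpan F V m ≤ lowSpan F V n := by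
  refine Submodule.span_mono ?_
  rintro x (⟨i, hi, rfl⟩ | ⟨i, hi, rfl⟩)
  · exact Or.inl ⟨i, by omega, rfl⟩
  · exact Or.inr ⟨i, by omega, rfl⟩

theorem intCast_mul_mem {M : Submodule ℤ A} (k : ℤ) {x : A} (hx : x ∈ M) : (k : A) * x ∈ M := by
  rw [← zsmul_eq_mul]
  exact M.smul_mem k hx

/-- Cancelling `FV = q` leaves a multiple of a power of `F` or of `V`. -/
theorem pow_mul_pow_mem_lowSpan {F V : A} {q : ℕ} (hFV : F * V = q) {a b n : ℕ}
    (h₁ : a < n + b) (h₂ : b < n + a) : F ^ a * V ^ b ∈ lowSpan F V n := by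
  rcases le_total a b with h | h
  · obtain ⟨k, rfl⟩ := Nat.exists_eq_add_of_le h
    have : F ^ a * V ^ (a + k) = ((q ^ a : ℕ) : ℤ) * V ^ k := by
      rw [pow_add, ← mul_assoc, ← mul_pow, hFV]
      push_cast
      ring
    rw [this]
    exact intCast_mul_mem _ (pow_right_mem_lowSpan (by omega))
  · obtain ⟨k, rfl⟩ := Nat.exists_eq_add_of_le h
    have : F ^ (b + k) * V ^ b = ((q ^ b : ℕ) : ℤ) * F ^ k := by
      rw [pow_add, mul_right_comm, ← mul_pow, hFV]
      push_cast
      ring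
    rw [this]
    exact intCast_mul_mem _ (pow_left_mem_lowSpan (by omega))

/-- Width `n` means exponents at most `n - 1`, the largest exponents of two factors add
up, and cancelling `FV = q` only lowers exponents. -/
theorem mul_mem_lowSpan {F V : A} {q : ℕ} (hFV : F * V = q) {a b : ℕ} {x y : A}
    (hx : x ∈ lowSpan F V a) (hy : y ∈ lowSpan F V b) : x * y ∈ lowSpan F V (a + b - 1) := by
  refine Submodule.span_induction₂ (p := fun x y _ _ => x * y ∈ lowSpan F V (a + b - 1))
    ?_ ?_ ?_ ?_ ?_ ?_ ?_ hx hy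
  · rintro x y (⟨i, hi, rfl⟩ | ⟨i, hi, rfl⟩) (⟨j, hj, rfl⟩ | ⟨j, hj, rfl⟩)
    · rw [← pow_add]
      exact pow_left_mem_lowSpan (by omega)
    · exact pow_mul_pow_mem_lowSpan hFV (by omega) (by omega)
    · rw [mul_comm]
      exact pow_mul_pow_mem_lowSpan hFV (by omega) (by omega)
    · rw [← pow_add]
      exact pow_right_mem_lowSpan (by omega)
  · intro y _
    simp
  · intro x _
    simp
  · intro x y z _ _ _ h₁ h₂
    rw [add_mul]
    exact add_mem h₁ h₂
  · intro x y z _ _ _ h₁ h₂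
    rw [mul_add]
    exact add_mem h₁ h₂
  · intro r x y _ _ h
    rw [smul_mul_assoc]
    exact Submodule.smul_mem _ r h
  · intro r x y _ _ h
    rw [mul_smul_comm]
    exact Submodule.smul_mem _ r h

/-- An element is balanced of width `D` if it is `F^D ± V^D` up to an integral combination of
lower powers of `F` and `V`. For `D = 0` the two extreme terms merge, and `1` is meant. -/
def IsBalanced (F V : A) (D : ℕ) (h : A) : Prop :=
  (D = 0 ∧ h = 1) ∨
    (0 < D ∧ ∃ ε : ℤ, IsUnit ε ∧ h - F ^ D - ε * V ^ D ∈ lowSpan F V D)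

theorem isBalanced_one (F V : A) : IsBalanced F V 0 1 := Or.inl ⟨rfl, rfl⟩

theorem isBalanced_sub (F V : A) : IsBalanced F V 1 (F - V) :=
  Or.inr ⟨one_pos, -1, by simp, by simp⟩

theorem IsBalanced.mul {F V : A} {q : ℕ} (hFV : F * V = q) {D E : ℕ} {g h : A}
    (hg : IsBalanced F V D g) (hh : IsBalanced F V E h) : IsBalanced F V (D + E) (g * h) := by
  obtain ⟨rfl, rfl⟩ | ⟨hD, ε, hε, hg⟩ := hg
  · simpa using hh
  obtain ⟨rfl, rfl⟩ | ⟨hE, δ, hδ, hh⟩ := hh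
  · exact Or.inr ⟨by omega, ε, hε, by simpa using hg⟩
  refine Or.inr ⟨by omega, ε * δ, hε.mul hδ, ?_⟩
  have e : g * h - F ^ (D + E) - ((ε * δ : ℤ) : A) * V ^ (D + E) =
      (g - F ^ D - ε * V ^ D) * (h - F ^ E - δ * V ^ E) +
      ((g - F ^ D - ε * V ^ D) * F ^ E + δ * ((g - F ^ D - ε * V ^ D) * V ^ E)) +
      (F ^ D * (h - F ^ E - δ * V ^ E) + ε * (V ^ D * (h - F ^ E - δ * V ^ E))) +
      (δ * (F ^ D * V ^ E) + ε * (F ^ E * V ^ D)) := by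
    push_cast
    ring
  rw [e]
  refine add_mem (add_mem (add_mem ?_ (add_mem ?_ (intCast_mul_mem _ ?_)))
    (add_mem ?_ (intCast_mul_mem _ ?_)))
    (add_mem (intCast_mul_mem _ ?_) (intCast_mul_mem _ ?_))
  · exact lowSpan_mono (by omega) (mul_mem_lowSpan hFV hg hh)
  · exact mul_mem_lowSpan (b := E + 1) hFV hg (pow_left_mem_lowSpan (by omega))
  · exact mul_mem_lowSpan (b := E + 1) hFV hg (pow_right_mem_lowSpan (by omega))
  · exact lowSpan_mono (by omega)
      (mul_mem_lowSpan (a := D + 1) hFV (pow_left_mem_lowSpan (by omega)) hh)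
  · exact lowSpan_mono (by omega)
      (mul_mem_lowSpan (a := D + 1) hFV (pow_right_mem_lowSpan (by omega)) hh)
  · exact pow_mul_pow_mem_lowSpan hFV (by omega) (by omega)
  · exact pow_mul_pow_mem_lowSpan hFV (by omega) (by omega)

theorem isBalanced_prod {F V : A} {q : ℕ} (hFV : F * V = q) {ι : Type*} (s : Finset ι)
    (D : ι → ℕ) (h : ι → A) (H : ∀ i ∈ s, IsBalanced F V (D i) (h i)) :
    IsBalanced F V (∑ i ∈ s, D i) (∏ i ∈ s, h i) := by
  classical
  induction s using Finset.induction_on with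
  | empty => simpa using isBalanced_one F V
  | insert a s ha ih =>
    rw [Finset.sum_insert ha, Finset.prod_insert ha]
    exact (H a (Finset.mem_insert_self a s)).mul hFV
      (ih fun i hi => H i (Finset.mem_insert_of_mem hi))

theorem eval_symmetrization (F V : A) (P : Polynomial ℤ) :
    MvPolynomial.eval₂Hom (Int.castRingHom A) ![F, V] (symmetrization P) =
      (P.coeff (P.natDegree / 2) : A) + ∑ r ∈ Finset.Icc 1 (P.natDegree / 2),
        (P.coeff (P.natDegree / 2 + r) : A) * (F ^ r + V ^ r) := by
  simp [symmetrization, -eq_intCast, MvPolynomial.eval₂_C]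

theorem isBalanced_symmetrization {F V : A} {P : Polynomial ℤ} (hP : P.Monic)
    (heven : Even P.natDegree) (hpos : 0 < P.natDegree) :
    IsBalanced F V (P.natDegree / 2)
      (MvPolynomial.eval₂Hom (Int.castRingHom A) ![F, V] (symmetrization P)) := by
  obtain ⟨d, hd⟩ := heven
  have hd2 : P.natDegree / 2 = d := by omega
  rw [eval_symmetrization, hd2]
  refine Or.inr ⟨by omega, 1, isUnit_one, ?_⟩
  obtain ⟨e, rfl⟩ : ∃ e, d = e + 1 := ⟨d - 1, by omega⟩
  have hc : P.coeff (e + 1 + (e + 1)) = 1 := by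
    rw [← hd]
    exact hP
  rw [Finset.sum_Icc_succ_top (by omega), hc]
  rw [Int.cast_one, one_mul, one_mul]
  have e1 : ∀ a s : A, a + (s + (F ^ (e + 1) + V ^ (e + 1))) - F ^ (e + 1) - V ^ (e + 1)
      = a + s := fun a s => by ring
  rw [e1]
  refine add_mem ?_ (sum_mem fun r hr => intCast_mul_mem _ (add_mem ?_ ?_))
  · simpa using intCast_mul_mem (P.coeff (e + 1))
      (pow_left_mem_lowSpan (F := F) (V := V) (Nat.succ_pos e))
  · exact pow_left_mem_lowSpan (by have := Finset.mem_Icc.1 hr; omega)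
  · exact pow_right_mem_lowSpan (by have := Finset.mem_Icc.1 hr; omega)

/-- The `2D` powers `F^i`, `0 ≤ i < D`, and `V^j`, `1 ≤ j ≤ D`. -/
def powerFamily (F V : A) (D : ℕ) : Fin D ⊕ Fin D → A :=
  Sum.elim (fun i => F ^ (i : ℕ)) (fun j => V ^ (j + 1 : ℕ))

theorem map_powerFamily {B : Type*} [CommRing B] (f : A →+* B) (F V : A) (D : ℕ)
    (i : Fin D ⊕ Fin D) : f (powerFamily F V D i) = powerFamily (f F) (f V) D i := by
  rcases i with i | j
  · exact map_pow f F _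
  · exact map_pow f V _

theorem pow_left_mem_span {F V : A} {D i : ℕ} (h : i < D) :
    F ^ i ∈ Submodule.span ℤ (Set.range (powerFamily F V D)) :=
  Submodule.subset_span ⟨Sum.inl ⟨i, h⟩, rfl⟩

theorem pow_right_mem_span {F V : A} {D i : ℕ} (h : i ≤ D) (h0 : 0 < D) :
    V ^ i ∈ Submodule.span ℤ (Set.range (powerFamily F V D)) := by
  rcases i with _ | i
  · simpa using pow_left_mem_span (F := F) (V := V) h0
  · exact Submodule.subset_span ⟨Sum.inr ⟨i, h⟩, rfl⟩

theorem lowSpan_le_span {F V : A} {D : ℕ} :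
    lowSpan F V D ≤ Submodule.span ℤ (Set.range (powerFamily F V D)) := by
  refine Submodule.span_le.2 ?_
  rintro x (⟨i, hi, rfl⟩ | ⟨i, hi, rfl⟩)
  · exact pow_left_mem_span hi
  · exact pow_right_mem_span hi.le (by omega)

/-- If a balanced element of width `D` is zero, then the relation it gives rewrites `F^D` and,
because its coefficient at `V^D` is a unit as well, also `V^{D+1}`. -/
theorem span_powerFamily_eq_top {F V : A} {q : ℕ} (hFV : F * V = q) {D : ℕ}
    (hgen : Algebra.adjoin ℤ {F, V} = ⊤) (h : IsBalanced F V D 0) :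
    Submodule.span ℤ (Set.range (powerFamily F V D)) = ⊤ := by
  obtain ⟨rfl, h⟩ | ⟨hD, ε, hε, hrel⟩ := h
  · have : Subsingleton A := subsingleton_of_zero_eq_one h
    exact Subsingleton.elim _ _
  set N := Submodule.span ℤ (Set.range (powerFamily F V D)) with hN
  have hεε : (ε : A) * ε = 1 := by
    rcases Int.isUnit_iff.1 hε with rfl | rfl <;> simp
  have hFD : F ^ D ∈ N := by
    have h1 : F ^ D = -(0 - F ^ D - ε * V ^ D) - ε * V ^ D := by ring
    rw [h1]
    exact sub_mem (neg_mem (lowSpan_le_span hrel))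
      (intCast_mul_mem _ (pow_right_mem_span le_rfl hD))
  have hmulF : ∀ x ∈ N, F * x ∈ N := by
    intro x hx
    induction hx using Submodule.span_induction with
    | mem x hx =>
      obtain ⟨i | j, rfl⟩ := hx
      · change F * F ^ (i : ℕ) ∈ N
        rw [← pow_succ']
        rcases Nat.lt_or_ge (i + 1) D with h | h
        · exact pow_left_mem_span h
        · have : (i : ℕ) + 1 = D := by omega
          rwa [this]
      · change F * V ^ (j + 1 : ℕ) ∈ N
        have := pow_mul_pow_mem_lowSpan hFV (a := 1) (b := j + 1) (n := D) (by omega) (by omega)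
        rw [pow_one] at this
        exact lowSpan_le_span this
    | zero => simp
    | add x y _ _ hx hy => rw [mul_add]; exact add_mem hx hy
    | smul r x _ hx => rw [mul_smul_comm]; exact N.smul_mem r hx
  have hmulLow : ∀ x ∈ lowSpan F V D, V * x ∈ N := by
    intro x hx
    induction hx using Submodule.span_induction with
    | mem x hx =>
      obtain ⟨i, hi, rfl⟩ | ⟨i, hi, rfl⟩ := hx
      · rcases i with _ | i
        · rw [pow_zero, mul_one, ← pow_one V]
          exact pow_right_mem_span hD hD
        · have := pow_mul_pow_mem_lowSpan hFV (a := i + 1) (b := 1) (n := D) (by omega) (by omega)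
          rw [pow_one, mul_comm] at this
          exact lowSpan_le_span this
      · rw [← pow_succ']
        exact pow_right_mem_span hi hD
    | zero => simp
    | add x y _ _ hx hy => rw [mul_add]; exact add_mem hx hy
    | smul r x _ hx => rw [mul_smul_comm]; exact N.smul_mem r hx
  have hVD : V * V ^ D ∈ N := by
    have h1 : V * V ^ D = (ε : A) * (-(V * (0 - F ^ D - ε * V ^ D)) - F ^ D * V ^ 1) := by
      linear_combination (-V * V ^ D) * hεε
    rw [h1]
    exact intCast_mul_mem _ (sub_mem (neg_mem (hmulLow _ hrel))
      (lowSpan_le_span (pow_mul_pow_mem_lowSpan hFV (by omega) (by omega))))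
  have hmulV : ∀ x ∈ N, V * x ∈ N := by
    intro x hx
    induction hx using Submodule.span_induction with
    | mem x hx =>
      obtain ⟨i | j, rfl⟩ := hx
      · exact hmulLow _ (pow_left_mem_lowSpan i.2)
      · change V * V ^ (j + 1 : ℕ) ∈ N
        rcases Nat.lt_or_ge (j + 1) D with h | h
        · rw [← pow_succ']
          exact pow_right_mem_span h hD
        · have : (j : ℕ) + 1 = D := by omega
          rwa [this]
    | zero => simp
    | add x y _ _ hx hy => rw [mul_add]; exact add_mem hx hy
    | smul r x _ hx => rw [mul_smul_comm]; exact N.smul_mem r hx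
  have hone : (1 : A) ∈ N := by simpa using pow_left_mem_span (F := F) (V := V) hD
  rw [eq_top_iff]
  rintro x -
  have hx : x ∈ Algebra.adjoin ℤ {F, V} := hgen ▸ Algebra.mem_top
  suffices h : ∀ y ∈ N, x * y ∈ N by simpa using h 1 hone
  induction hx using Algebra.adjoin_induction with
  | mem x hx =>
    rcases hx with rfl | rfl
    · exact hmulF
    · exact hmulV
  | algebraMap r =>
    intro y hy
    rw [eq_intCast]
    exact intCast_mul_mem _ hy
  | add x y _ _ hx hy => intro z hz; rw [add_mul]; exact add_mem (hx z hz) (hy z hz)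
  | mul x y _ _ hx hy => intro z hz; rw [mul_assoc]; exact hx _ (hy z hz)

end Balanced

/-! ### Gorenstein orders -/

section Gorenstein

/-- The `R`-module of additive maps `R → D`, on which `r` acts by `(r • φ) x = φ (x * r)`. -/
def Coinduced (R D : Type*) [CommRing R] [AddCommGroup D] : Type _ := R →+ D

namespace Coinduced

variable {R D : Type*} [CommRing R] [AddCommGroup D]

instance : AddCommGroup (Coinduced R D) := inferInstanceAs (AddCommGroup (R →+ D))

/-- The additive map underlying an element of the coinduced module. -/
def toHom (φ : Coinduced R D) : R →+ D := φ

theorem ext {φ ψ : Coinduced R D} (h : ∀ x, φ.toHom x = ψ.toHom x) : φ = ψ :=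
  AddMonoidHom.ext h

instance : Module R (Coinduced R D) where
  smul r φ := φ.toHom.comp (AddMonoidHom.mulRight r)
  one_smul φ := ext fun x => congrArg φ.toHom (mul_one x)
  mul_smul r s φ := ext fun x => congrArg φ.toHom (by
    change x * (r * s) = x * r * s
    rw [mul_assoc])
  smul_zero _ := rfl
  smul_add _ _ _ := rfl
  add_smul r s φ := ext fun x => by
    change φ.toHom (x * (r + s)) = φ.toHom (x * r) + φ.toHom (x * s)
    rw [mul_add, map_add]
  zero_smul φ := ext fun x => by
    change φ.toHom (x * 0) = 0
    rw [mul_zero, map_zero]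

theorem toHom_smul (r : R) (φ : Coinduced R D) (x : R) :
    (r • φ).toHom x = φ.toHom (x * r) := rfl

/-- An `R`-linear map `M → Hom(R, D)` is the same as an additive map `M → D`, so a module coinduced
from an injective abelian group is injective. -/
theorem injective (h : Module.Baer ℤ D) : Module.Injective R (Coinduced R D) := by
  refine Module.Baer.injective fun I g => ?_
  let e : I →+ D :=
    { toFun := fun x => (g x).toHom 1
      map_zero' := by rw [map_zero]; rfl
      map_add' := fun x y => by rw [map_add]; rfl }
  obtain ⟨φ, hφ⟩ := h.extension_property_addMonoidHom I.subtype.toAddMonoidHom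
    I.subtype_injective e
  refine ⟨LinearMap.toSpanSingleton R (Coinduced R D) φ, fun x hx => ext fun y => ?_⟩
  have h1 : (⟨y * x, I.mul_mem_left y hx⟩ : I) = y • ⟨x, hx⟩ := rfl
  have h2 := DFunLike.congr_fun hφ ⟨y * x, I.mul_mem_left y hx⟩
  calc φ (y * x) = (g ⟨y * x, I.mul_mem_left y hx⟩).toHom 1 := h2
    _ = (g ⟨x, hx⟩).toHom y := by rw [h1, map_smul, toHom_smul, one_mul]

/-- Composition with a homomorphism of abelian groups. -/
def map {D' : Type*} [AddCommGroup D'] (R : Type*) [CommRing R] (f : D →+ D') :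
    Coinduced R D →ₗ[R] Coinduced R D' where
  toFun φ := f.comp φ.toHom
  map_add' φ ψ := ext fun x => map_add f (φ.toHom x) (ψ.toHom x)
  map_smul' _ _ := rfl

/-- The `R`-linear map `R → Hom(R, D)` that sends `1` to `φ`. -/
def orbit (φ : Coinduced R D) : R →ₗ[R] Coinduced R D :=
  LinearMap.toSpanSingleton R (Coinduced R D) φ

end Coinduced

open CategoryTheory in
/-- If `τ : R → ℤ` identifies `R` with its `ℤ`-dual, then `0 → ℤ → ℚ → ℚ/ℤ → 0` gives the injective
resolution `0 → R → Hom(R, ℚ) → Hom(R, ℚ/ℤ) → 0`. -/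
theorem hasInjectiveDimensionLE_one_of_perfect {R : Type} [CommRing R] [Module.Free ℤ R]
    (τ : R →+ ℤ) (hinj : ∀ a, (∀ x, τ (x * a) = 0) → a = 0)
    (hsurj : ∀ φ : R →+ ℤ, ∃ a, ∀ x, φ x = τ (x * a)) :
    HasInjectiveDimensionLE (ModuleCat.of R R) 1 := by
  let j : ℤ →+ ℚ := Int.castAddHom ℚ
  have hj : Function.Injective j := Int.cast_injective
  let p : ℚ →+ ℚ ⧸ j.range := QuotientAddGroup.mk' j.range
  have hp : Function.Surjective p := QuotientAddGroup.mk'_surjective _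
  let f : R →ₗ[R] Coinduced R ℚ := Coinduced.orbit (j.comp τ)
  let g : Coinduced R ℚ →ₗ[R] Coinduced R (ℚ ⧸ j.range) := Coinduced.map R p
  have hf : ∀ a x, (f a).toHom x = j (τ (x * a)) := fun a x => rfl
  have hg : ∀ φ x, (g φ).toHom x = p (φ.toHom x) := fun φ x => rfl
  have hgf : g.comp f = 0 := LinearMap.ext fun a => Coinduced.ext fun x => by
    change p (j (τ (x * a))) = 0
    exact (QuotientAddGroup.eq_zero_iff _).2 ⟨_, rfl⟩
  have hexact : Function.Exact f g := by
    intro φ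
    constructor
    · intro h
      have h1 : ∀ x, ∃ n : ℤ, j n = φ.toHom x := fun x => by
        have h0 : p (φ.toHom x) = 0 := by
          rw [← hg, h]
          rfl
        exact (QuotientAddGroup.eq_zero_iff _).1 h0
      choose n hn using h1
      let ψ : R →+ ℤ := AddMonoidHom.mk' n fun x y => hj (by
        rw [map_add, hn, hn, hn, map_add])
      obtain ⟨a, ha⟩ := hsurj ψ
      refine ⟨a, Coinduced.ext fun x => ?_⟩
      rw [hf, ← ha, ← hn]
      rfl
    · rintro ⟨a, rfl⟩
      exact LinearMap.congr_fun hgf a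
  have hfinj : Function.Injective f := by
    rw [injective_iff_map_eq_zero]
    intro a ha
    refine hinj a fun x => hj ?_
    rw [← hf, ha, map_zero]
    rfl
  have hgsurj : Function.Surjective g := by
    intro φ
    let b := Module.Free.chooseBasis ℤ R
    choose s hs using fun i => hp (φ.toHom (b i))
    let ψ : R →ₗ[ℤ] ℚ := b.constr ℤ s
    refine ⟨(ψ.toAddMonoidHom : R →+ ℚ), ?_⟩
    have h : (p.toIntLinearMap.comp ψ) = φ.toHom.toIntLinearMap := b.ext fun i => by
      simp [ψ, hs]
    exact Coinduced.ext fun x => LinearMap.congr_fun h x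
  let S : ShortComplex (ModuleCat R) := ModuleCat.shortComplexOfCompEqZero f g hgf
  have hS : S.ShortExact := ModuleCat.shortComplex_shortExact S hexact hfinj hgsurj
  have h₂ : Injective (ModuleCat.of R (Coinduced R ℚ)) :=
    (Module.injective_iff_injective_object R _).1
      (Coinduced.injective (Module.Baer.of_divisible ℚ))
  let hdiv : DivisibleBy (ℚ ⧸ j.range) ℤ :=
    Function.Surjective.divisibleBy p hp fun x n => map_zsmul p n x
  have h₃ : Injective (ModuleCat.of R (Coinduced R (ℚ ⧸ j.range))) :=
    (Module.injective_iff_injective_object R _).1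
      (Coinduced.injective (Module.Baer.of_divisible _))
  have h₃' : HasInjectiveDimensionLT S.X₃ 1 := inferInstanceAs
    (HasInjectiveDimensionLT (ModuleCat.of R (Coinduced R (ℚ ⧸ j.range))) 1)
  have h₂' : HasInjectiveDimensionLT (ModuleCat.of R (Coinduced R ℚ)) 1 := inferInstance
  exact hS.hasInjectiveDimensionLT_X₁ 1 h₃' (hasInjectiveDimensionLT_of_ge S.X₂ 1 2 (by omega))

open CategoryTheory in
theorem isGorensteinRing_of_hasInjectiveDimensionLE {R : Type} [CommRing R] [IsNoetherianRing R]
    {n : ℕ} (h : HasInjectiveDimensionLE (ModuleCat.of R R) n) : IsGorensteinRing R := by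
  refine ⟨inferInstance, fun P _ => ⟨?_, inferInstance, n, ?_⟩⟩
  · exact IsLocalization.isNoetherianRing P.primeCompl _ inferInstance
  · have h1 := ModuleCat.localizedModule_hasInjectiveDimensionLE n P.primeCompl (ModuleCat.of R R)
    have h2 := ModuleCat.localizedModule_isLocalizedModule (ModuleCat.of R R) P.primeCompl
    let e : (ModuleCat.of R R).localizedModule P.primeCompl ≃ₗ[R] Localization P.primeCompl :=
      IsLocalizedModule.linearEquiv P.primeCompl
        ((ModuleCat.of R R).localizedModuleMkLinearMap P.primeCompl)
        (Algebra.linearMap R (Localization P.primeCompl))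
    let e' := e.extendScalarsOfIsLocalization P.primeCompl (Localization P.primeCompl)
    exact (ModuleCat.hasInjectiveDimensionLE_iff_of_linearEquiv
      (N := ModuleCat.of (Localization P.primeCompl) (Localization P.primeCompl)) e' n).1 h1

/-- In the basis `F^i`, `V^j` the pairing `(x, y) ↦ τ (x * y)`, with `τ` the coordinate at `V^D`, is
antitriangular for the filtration by the exponent, with diagonal blocks signed permutation
matrices. Hence every functional is `τ (· * a)`, the element `a` being found by solving for the
values of the functional at `F^k` and `V^k` for increasing `k`. -/
theorem exists_eq_functional_mul {R : Type*} [CommRing R] {F V : R} {q : ℕ} (hFV : F * V = q)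
    {D : ℕ} (hspan : Submodule.span ℤ (Set.range (powerFamily F V D)) = ⊤)
    (τ : R →+ ℤ) (hτ : ∀ x ∈ lowSpan F V D, τ x = 0) (hF : IsUnit (τ (F ^ D)))
    (hV : IsUnit (τ (V ^ D))) (φ : R →+ ℤ) : ∃ a, ∀ x, φ x = τ (x * a) := by
  have hmul : ∀ a b : ℕ, 0 < a → 0 < b → a ≤ D → b ≤ D → τ (F ^ a * V ^ b) = 0 :=
    fun a b h1 h2 h3 h4 => hτ _ (pow_mul_pow_mem_lowSpan hFV (by omega) (by omega))
  have hmul' : ∀ a b : ℕ, 0 < a → 0 < b → a ≤ D → b ≤ D → τ (V ^ b * F ^ a) = 0 :=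
    fun a b h1 h2 h3 h4 => by rw [mul_comm]; exact hmul a b h1 h2 h3 h4
  have hτF : ∀ a b : ℕ, a + b < D → τ (F ^ a * F ^ b) = 0 := fun a b h => by
    rw [← pow_add]; exact hτ _ (pow_left_mem_lowSpan h)
  have hτV : ∀ a b : ℕ, a + b < D → τ (V ^ a * V ^ b) = 0 := fun a b h => by
    rw [← pow_add]; exact hτ _ (pow_right_mem_lowSpan h)
  have hsq : ∀ {u : ℤ}, IsUnit u → u * u = 1 := fun hu => by
    rcases Int.isUnit_iff.1 hu with rfl | rfl <;> rfl
  have hsub : ∀ (c : ℤ) (x y : R), τ (x * (c * y)) = c * τ (x * y) := fun c x y => by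
    rw [mul_left_comm, ← zsmul_eq_mul, map_zsmul, smul_eq_mul]
  have key : ∀ s ≤ D, ∃ a, ∀ k < s, φ (F ^ k) = τ (F ^ k * a) ∧ φ (V ^ k) = τ (V ^ k * a) := by
    intro s
    induction s with
    | zero => exact fun _ => ⟨0, fun k hk => absurd hk (Nat.not_lt_zero k)⟩
    | succ s ih =>
      intro hs
      obtain ⟨a, ha⟩ := ih (by omega)
      rcases Nat.eq_zero_or_pos s with rfl | hs0
      · -- the dual of `F^0 = V^0` is `V^D`
        refine ⟨((φ 1 * τ (V ^ D) : ℤ) : R) * V ^ D, fun k hk => ?_⟩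
        obtain rfl : k = 0 := by omega
        have : φ 1 = τ (1 * (((φ 1 * τ (V ^ D) : ℤ) : R) * V ^ D)) := by
          rw [hsub, one_mul, mul_assoc, hsq hV, mul_one]
        exact ⟨by simpa using this, by simpa using this⟩
      · -- for `0 < s < D` the duals of `F^s` and `V^s` are `F^(D-s)` and `V^(D-s)`
        refine ⟨a + (((φ (F ^ s) - τ (F ^ s * a)) * τ (F ^ D) : ℤ) : R) * F ^ (D - s) +
          (((φ (V ^ s) - τ (V ^ s * a)) * τ (V ^ D) : ℤ) : R) * V ^ (D - s), fun k hk => ?_⟩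
        rw [mul_add, mul_add, mul_add, mul_add, map_add, map_add, map_add, map_add,
          hsub, hsub, hsub, hsub]
        rcases Nat.eq_zero_or_pos k with rfl | hk0
        · have h1 := ha 0 hs0
          have h2 : τ (F ^ (D - s)) = 0 := hτ _ (pow_left_mem_lowSpan (by omega))
          have h3 : τ (V ^ (D - s)) = 0 := hτ _ (pow_right_mem_lowSpan (by omega))
          simp only [pow_zero, one_mul] at h1 ⊢
          rw [h2, h3]
          simpa using h1.1
        · rw [hmul k (D - s) hk0 (by omega) (by omega) (by omega),
            hmul' (D - s) k (by omega) hk0 (by omega) (by omega)]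
          rcases Nat.lt_or_ge k s with hks | hks
          · rw [hτF k (D - s) (by omega), hτV k (D - s) (by omega)]
            simpa using ha k hks
          · obtain rfl : k = s := by omega
            rw [← pow_add, ← pow_add, Nat.add_sub_cancel' (by omega : k ≤ D)]
            constructor
            · linear_combination (-(φ (F ^ k) - τ (F ^ k * a))) * hsq hF
            · linear_combination (-(φ (V ^ k) - τ (V ^ k * a))) * hsq hV
  obtain ⟨a, ha⟩ := key D le_rfl
  -- the dual of `V^D` is `1`
  let c : ℤ := (φ (V ^ D) - τ (V ^ D * a)) * τ (V ^ D)
  refine ⟨a + (c : R) * 1, fun x => ?_⟩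
  have hx : x ∈ Submodule.span ℤ (Set.range (powerFamily F V D)) := hspan ▸ Submodule.mem_top
  induction hx using Submodule.span_induction with
  | mem x hx =>
    rw [mul_add, map_add, hsub, mul_one]
    obtain ⟨i | j, rfl⟩ := hx
    · change φ (F ^ (i : ℕ)) = τ (F ^ (i : ℕ) * a) + c * τ (F ^ (i : ℕ))
      rw [hτ _ (pow_left_mem_lowSpan i.2), (ha i i.2).1, mul_zero, add_zero]
    · change φ (V ^ (j + 1 : ℕ)) = τ (V ^ (j + 1 : ℕ) * a) + c * τ (V ^ (j + 1 : ℕ))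
      rcases Nat.lt_or_ge (j + 1) D with h | h
      · rw [hτ _ (pow_right_mem_lowSpan h), (ha _ h).2, mul_zero, add_zero]
      · have hj : (j : ℕ) + 1 = D := by omega
        rw [hj]
        linear_combination (-(φ (V ^ D) - τ (V ^ D * a))) * hsq hV
  | zero => simp
  | add x y _ _ hx hy => rw [map_add, hx, hy, add_mul, map_add]
  | smul r x _ hx => rw [map_zsmul, hx, smul_mul_assoc, map_zsmul]

theorem isGorensteinRing_of_isBalanced_zero {R : Type} [CommRing R] {F V : R} {q : ℕ}
    (hFV : F * V = q) {D : ℕ} (hD : 0 < D) (hbal : IsBalanced F V D 0)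
    (b : Module.Basis (Fin D ⊕ Fin D) ℤ R) (hb : ∀ i, b i = powerFamily F V D i) :
    IsGorensteinRing R := by
  have hb' : powerFamily F V D = b := funext fun i => (hb i).symm
  have hspan : Submodule.span ℤ (Set.range (powerFamily F V D)) = ⊤ := by
    rw [hb', b.span_eq]
  let last : Fin D := ⟨D - 1, by omega⟩
  let τ : R →+ ℤ := (b.coord (Sum.inr last)).toAddMonoidHom
  have hτb : ∀ i, τ (powerFamily F V D i) = if i = Sum.inr last then 1 else 0 := fun i => by
    rw [← hb]
    simp [τ, Finsupp.single_apply]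
  have hτF : ∀ i < D, τ (F ^ i) = 0 := fun i hi => by
    have := hτb (Sum.inl ⟨i, hi⟩)
    simpa [powerFamily] using this
  have hτV : ∀ i < D, τ (V ^ i) = 0 := fun i hi => by
    rcases i with _ | i
    · simpa using hτF 0 hD
    · have := hτb (Sum.inr ⟨i, by omega⟩)
      rw [if_neg (by simp only [last, Sum.inr.injEq, Fin.mk.injEq]; omega)] at this
      exact this
  have hτVD : τ (V ^ D) = 1 := by
    have := hτb (Sum.inr last)
    rw [if_pos rfl] at this
    have h : powerFamily F V D (Sum.inr last) = V ^ D := by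
      change V ^ (D - 1 + 1) = _
      rw [Nat.sub_add_cancel hD]
    rwa [h] at this
  have hτ : ∀ x ∈ lowSpan F V D, τ x = 0 := by
    intro x hx
    induction hx using Submodule.span_induction with
    | mem x hx =>
      obtain ⟨i, hi, rfl⟩ | ⟨i, hi, rfl⟩ := hx
      · exact hτF i hi
      · exact hτV i hi
    | zero => exact map_zero τ
    | add x y _ _ hx hy => rw [map_add, hx, hy, add_zero]
    | smul r x _ hx => rw [map_zsmul, hx, smul_zero]
  obtain ⟨h, -⟩ | ⟨-, ε, hε, hrel⟩ := hbal
  · omega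
  have hτFD : IsUnit (τ (F ^ D)) := by
    have h := hτ _ hrel
    rw [map_sub, map_sub, map_zero, ← zsmul_eq_mul, map_zsmul, hτVD, smul_eq_mul, mul_one] at h
    rw [show τ (F ^ D) = -ε by linarith]
    exact hε.neg
  have hsurj := exists_eq_functional_mul hFV hspan τ hτ hτFD (by rw [hτVD]; exact isUnit_one)
  have : Module.Free ℤ R := Module.Free.of_basis b
  have : Module.Finite ℤ R := Module.Finite.of_basis b
  have : IsNoetherianRing R := isNoetherian_of_tower ℤ inferInstance
  refine isGorensteinRing_of_hasInjectiveDimensionLE (n := 1)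
    (hasInjectiveDimensionLE_one_of_perfect τ (fun a ha => ?_) hsurj)
  refine b.ext_elem fun i => ?_
  obtain ⟨c, hc⟩ := hsurj (b.coord i).toAddMonoidHom
  have h := hc a
  rw [mul_comm, ha] at h
  rw [map_zero, Finsupp.zero_apply]
  exact h

end Gorenstein

/-! ### The functional equation of a minimal polynomial -/

section FunctionalEquation

open Polynomial ComplexConjugate

/-- The polynomial `x^n P(q/x)`, where `n` is the degree of `P`. -/
theorem sum_reflect_coeff_mul_pow {K : Type*} [CommRing K] (P : ℤ[X]) {q : ℕ} {x y : K}
    (hxy : x * y = q) :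
    ∑ i ∈ Finset.range (P.natDegree + 1),
      ((P.coeff (P.natDegree - i) * (q : ℤ) ^ (P.natDegree - i) : ℤ) : K) * x ^ i =
      x ^ P.natDegree * aeval y P := by
  rw [aeval_eq_sum_range, Finset.mul_sum, ← Finset.sum_range_reflect]
  refine Finset.sum_congr rfl fun i hi => ?_
  have hi' : i ≤ P.natDegree := by have := Finset.mem_range.1 hi; omega
  rw [Nat.add_sub_cancel, Nat.sub_sub_self hi', zsmul_eq_mul]
  obtain ⟨k, hk⟩ := Nat.exists_eq_add_of_le hi'
  rw [show P.natDegree - i = k by omega]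
  push_cast
  rw [← hxy, hk, mul_pow, pow_add]
  ring

/-- If `conj x = q / x`, then the minimal polynomial `P` of `x` satisfies
`x^n P(q/x) = P(0) P(x)`, because both sides vanish at `x` and have the same coefficient at
`x^n`. -/
theorem minpoly_coeff_mul_pow {x : ℂ} (hx : IsIntegral ℤ x) {q : ℕ} (hq : x * conj x = q) {j : ℕ}
    (hj : j ≤ (minpoly ℤ x).natDegree) :
    (minpoly ℤ x).coeff ((minpoly ℤ x).natDegree - j) * (q : ℤ) ^ ((minpoly ℤ x).natDegree - j) =
      (minpoly ℤ x).coeff 0 * (minpoly ℤ x).coeff j := by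
  set P := minpoly ℤ x with hP
  have hmonic : P.Monic := minpoly.monic hx
  set n := P.natDegree with hn
  let Q : ℤ[X] := ∑ i ∈ Finset.range (n + 1), C (P.coeff (n - i) * (q : ℤ) ^ (n - i)) * X ^ i
  have hQ : ∀ j ≤ n, Q.coeff j = P.coeff (n - j) * (q : ℤ) ^ (n - j) := by
    intro j hj
    simp only [Q, finsetSum_coeff, coeff_C_mul_X_pow]
    rw [Finset.sum_ite_eq, if_pos (Finset.mem_range.2 (by omega))]
  have hroot : aeval (conj x) P = 0 := by
    have h : aeval (conj x) P = conj (aeval x P) := by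
      rw [aeval_def, aeval_def, hom_eval₂]
      congr 1
      exact RingHom.ext_int _ _
    rw [h, hP, minpoly.aeval, map_zero]
  have hQx : aeval x Q = 0 := by
    have h := sum_reflect_coeff_mul_pow P hq
    rw [hroot, mul_zero] at h
    rw [← h]
    rw [map_sum]
    refine Finset.sum_congr rfl fun i _ => ?_
    rw [map_mul, aeval_C, map_pow, aeval_X]
    rfl
  have hzero : Q - C (P.coeff 0) * P = 0 := by
    by_contra hne
    have hle := minpoly.IsIntegrallyClosed.degree_le_of_ne_zero (s := x) hne (by
      rw [map_sub, map_mul, hQx, hP, minpoly.aeval, mul_zero, sub_zero])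
    rw [← hP, degree_eq_natDegree hmonic.ne_zero] at hle
    have hlt : (Q - C (P.coeff 0) * P).degree < n := by
      rw [degree_lt_iff_coeff_zero]
      intro m hm
      rw [coeff_sub, coeff_C_mul]
      rcases hm.eq_or_lt with rfl | hm
      · rw [hQ _ le_rfl, Nat.sub_self, pow_zero, mul_one, hmonic.coeff_natDegree, mul_one, sub_self]
      · rw [coeff_eq_zero_of_natDegree_lt hm, mul_zero, sub_zero]
        simp only [Q, finsetSum_coeff, coeff_C_mul_X_pow]
        refine Finset.sum_eq_zero fun i hi => if_neg ?_
        have := Finset.mem_range.1 hi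
        omega
    exact absurd hle (not_le.2 hlt)
  rw [← hQ j hj, ← coeff_C_mul, sub_eq_zero.1 hzero]

theorem pow_natDegree_eq_coeff_zero {x : ℂ} (hx : IsIntegral ℤ x) {q : ℕ} (hq : x * conj x = q)
    {s : ℝ} (hs : s * s = q) (hroot : aeval s (minpoly ℤ x) ≠ 0) :
    s ^ (minpoly ℤ x).natDegree = (minpoly ℤ x).coeff 0 := by
  have h := sum_reflect_coeff_mul_pow (minpoly ℤ x) hs
  refine mul_right_cancel₀ hroot ?_
  rw [← h, aeval_eq_sum_range, Finset.mul_sum]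
  refine Finset.sum_congr rfl fun i hi => ?_
  rw [minpoly_coeff_mul_pow hx hq (by have := Finset.mem_range.1 hi; omega), zsmul_eq_mul]
  push_cast
  ring

theorem aeval_minpoly_ne_zero {x : ℂ} (hx : IsIntegral ℤ x) (him : x.im ≠ 0) {q : ℕ}
    {s : ℝ} (hs : s * s = q) : aeval s (minpoly ℤ x) ≠ 0 := by
  intro h
  have h1 : minpoly ℚ x = (minpoly ℤ x).map (algebraMap ℤ ℚ) :=
    minpoly.isIntegrallyClosed_eq_field_fractions' ℚ hx
  have hxQ : IsIntegral ℚ x := hx.tower_top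
  have h2 : aeval s (minpoly ℚ x) = 0 := by
    rw [h1, aeval_map_algebraMap, h]
  have h3 : minpoly ℚ x = minpoly ℚ s :=
    minpoly.eq_of_irreducible_of_monic (minpoly.irreducible hxQ) h2 (minpoly.monic hxQ)
  have h4 : minpoly ℚ x ∣ X ^ 2 - C (q : ℚ) := by
    rw [h3]
    refine minpoly.dvd ℚ s ?_
    simp [pow_two, hs]
  have h5 : aeval x (X ^ 2 - C (q : ℚ)) = 0 := by
    obtain ⟨r, hr⟩ := h4
    rw [hr, map_mul, minpoly.aeval, zero_mul]
  have h6 : (x - s) * (x + s) = 0 := by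
    have h7 : x ^ 2 - (q : ℂ) = 0 := by simpa using h5
    have h8 : (s : ℂ) * s = q := by exact_mod_cast congrArg (fun t : ℝ => (t : ℂ)) hs
    linear_combination h7 - h8
  rcases mul_eq_zero.1 h6 with h | h
  · exact him (by rw [sub_eq_zero.1 h, Complex.ofReal_im])
  · exact him (by rw [eq_neg_of_add_eq_zero_left h, Complex.neg_im, Complex.ofReal_im, neg_zero])

/-- The minimal polynomial of a non-real Weil number has no root `±√q`, so evaluating the functional
equation there gives `P(0) = (√q)^n = (-√q)^n`; hence `n` is even and `P(0) = q^{n/2}`. -/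
theorem even_natDegree_minpoly {x : ℂ} (hx : IsIntegral ℤ x) (him : x.im ≠ 0) {q : ℕ}
    (hq0 : 0 < q) (hq : x * conj x = q) :
    Even (minpoly ℤ x).natDegree ∧
      (minpoly ℤ x).coeff 0 = (q : ℤ) ^ ((minpoly ℤ x).natDegree / 2) := by
  have hs : √(q : ℝ) * √(q : ℝ) = q := Real.mul_self_sqrt (Nat.cast_nonneg q)
  have hs' : -√(q : ℝ) * -√(q : ℝ) = q := by rw [neg_mul_neg, hs]
  have hpos : 0 < √(q : ℝ) := Real.sqrt_pos.2 (by exact_mod_cast hq0)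
  have h1 := pow_natDegree_eq_coeff_zero hx hq hs (aeval_minpoly_ne_zero hx him hs)
  have h2 := pow_natDegree_eq_coeff_zero hx hq hs' (aeval_minpoly_ne_zero hx him hs')
  have heven : Even (minpoly ℤ x).natDegree := by
    by_contra h
    rw [Nat.not_even_iff_odd] at h
    rw [h.neg_pow, ← h1] at h2
    have := pow_pos hpos (minpoly ℤ x).natDegree
    linarith
  refine ⟨heven, ?_⟩
  obtain ⟨d, hd⟩ := heven
  have hd2 : (minpoly ℤ x).natDegree / 2 = d := by omega
  rw [hd2]
  rw [hd, pow_add, ← mul_pow, hs] at h1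
  exact_mod_cast h1.symm

theorem minpoly_coeff_sub {x : ℂ} (hx : IsIntegral ℤ x) (him : x.im ≠ 0) {q : ℕ}
    (hq0 : 0 < q) (hq : x * conj x = q) {d r : ℕ} (hd : (minpoly ℤ x).natDegree = d + d)
    (hr : r ≤ d) : (minpoly ℤ x).coeff (d - r) = (q : ℤ) ^ r * (minpoly ℤ x).coeff (d + r) := by
  have h0 := (even_natDegree_minpoly hx him hq0 hq).2
  rw [show (minpoly ℤ x).natDegree / 2 = d by omega] at h0
  have h := minpoly_coeff_mul_pow hx hq (j := d + r) (by omega)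
  rw [h0, show (minpoly ℤ x).natDegree - (d + r) = d - r by omega] at h
  have hqz : (q : ℤ) ^ (d - r) ≠ 0 := pow_ne_zero _ (by exact_mod_cast hq0.ne')
  refine mul_right_cancel₀ hqz ?_
  rw [h, mul_right_comm, ← pow_add, Nat.add_sub_cancel' hr]

/-- If the coefficients of `P` satisfy `a_{d-r} = q^r a_{d+r}`, then `P(F) = F^d h(F, q/F)` for the
symmetrization `h` of `P`. -/
theorem eval_symmetrization_eq_zero {K : Type*} [Field K] {P : ℤ[X]} {q d : ℕ}
    (hd : P.natDegree = d + d)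
    (hcoeff : ∀ r ≤ d, P.coeff (d - r) = (q : ℤ) ^ r * P.coeff (d + r))
    {F V : K} (hF : F ≠ 0) (hFV : F * V = q) (hroot : aeval F P = 0) :
    MvPolynomial.eval₂Hom (Int.castRingHom K) ![F, V] (symmetrization P) = 0 := by
  have hd2 : P.natDegree / 2 = d := by omega
  rw [eval_symmetrization, hd2]
  refine (mul_eq_zero.1 (?_ : F ^ d * _ = 0)).resolve_left (pow_ne_zero d hF)
  have hIcc : Finset.Icc 1 d = Finset.Ico 1 (d + 1) := by
    ext
    simp only [Finset.mem_Icc, Finset.mem_Ico]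
    omega
  rw [← hroot, aeval_eq_sum_range, hd, add_assoc, Finset.sum_range_add,
    Finset.sum_range_succ', ← Finset.sum_range_reflect, hIcc, Finset.sum_Ico_eq_sum_range,
    Nat.add_sub_cancel, ← add_assoc, ← Finset.sum_add_distrib, mul_add, Finset.mul_sum, add_comm]
  congr 1
  · refine Finset.sum_congr rfl fun i hi => ?_
    have hi' : i + 1 ≤ d := by have := Finset.mem_range.1 hi; omega
    rw [show d - 1 - i = d - (i + 1) by omega, hcoeff _ hi', zsmul_eq_mul, zsmul_eq_mul,
      add_comm 1 i]
    obtain ⟨k, hk⟩ := Nat.exists_eq_add_of_le hi'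
    rw [show d - (i + 1) = k by omega]
    push_cast
    rw [← hFV, pow_add F d, hk]
    ring
  · rw [zsmul_eq_mul, add_zero, mul_comm]

end FunctionalEquation

/-! ### The factor of a single conjugacy class -/

namespace WeilClass

open Polynomial ComplexConjugate

variable {q : ℕ} (c : WeilClass q)

theorem rep_injective : Function.Injective (WeilClass.rep (q := q)) :=
  Subtype.val_injective.comp Quotient.out_injective

theorem isIntegral_rep : IsIntegral ℤ c.rep := c.isWeilNumber_rep.1

theorem algebraMap_gen : algebraMap c.field ℂ c.gen = c.rep :=
  IntermediateField.AdjoinSimple.algebraMap_gen ℚ c.rep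

theorem norm_rep : ‖c.rep‖ = √(q : ℝ) := by
  have h : ‖algebraMap c.field ℂ c.gen‖ = √(q : ℝ) := c.isWeilNumber_rep.2 _
  rwa [algebraMap_gen] at h

theorem rep_mul_conj : c.rep * conj c.rep = q := by
  rw [Complex.mul_conj, Complex.normSq_eq_norm_sq, norm_rep, Real.sq_sqrt (Nat.cast_nonneg q)]
  simp

theorem rep_mul_self (h : c.rep.im = 0) : c.rep * c.rep = q := by
  have h1 : conj c.rep = c.rep := Complex.conj_eq_iff_im.2 h
  have h2 := c.rep_mul_conj
  rwa [h1] at h2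

theorem rep_ne_zero (hq : 0 < q) : c.rep ≠ 0 := by
  rw [← norm_ne_zero_iff, norm_rep]
  exact (Real.sqrt_pos.2 (by exact_mod_cast hq)).ne'

theorem gen_ne_zero (hq : 0 < q) : c.gen ≠ 0 := fun h =>
  c.rep_ne_zero hq (by rw [← c.algebraMap_gen, h, map_zero])

theorem aeval_gen_eq_zero_iff (p : ℤ[X]) : aeval c.gen p = 0 ↔ minpoly ℤ c.rep ∣ p := by
  have h := aeval_algebraMap_apply ℂ c.gen p
  rw [algebraMap_gen] at h
  rw [← minpoly.isIntegrallyClosed_dvd_iff c.isIntegral_rep, h, map_eq_zero (algebraMap c.field ℂ)]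

theorem finrank_field : Module.finrank ℚ c.field = (minpoly ℤ c.rep).natDegree := by
  have hQ : IsIntegral ℚ c.rep := c.isIntegral_rep.tower_top
  rw [IntermediateField.adjoin.finrank hQ,
    minpoly.isIntegrallyClosed_eq_field_fractions' ℚ c.isIntegral_rep,
    (minpoly.monic c.isIntegral_rep).natDegree_map]

theorem finrank_field_pos : 0 < Module.finrank ℚ c.field := by
  rw [finrank_field]
  exact minpoly.natDegree_pos c.isIntegral_rep

/-- The Weil number `π` is rational. -/
def IsRational : Prop := c.rep ∈ Set.range (algebraMap ℚ ℂ)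

theorem im_rep_of_isRational {c : WeilClass q} (h : c.IsRational) : c.rep.im = 0 := by
  obtain ⟨r, hr⟩ := h
  rw [← hr]
  simp

theorem finrank_field_eq_one_iff : Module.finrank ℚ c.field = 1 ↔ c.IsRational := by
  rw [IntermediateField.finrank_adjoin_simple_eq_one_iff, IntermediateField.mem_bot, IsRational]

theorem finrank_field_of_im_eq_zero (h : c.rep.im = 0) (h' : ¬ c.IsRational) :
    Module.finrank ℚ c.field = 2 := by
  have h1 : Module.finrank ℚ c.field ≤ 2 := by
    have hdvd : minpoly ℤ c.rep ∣ X ^ 2 - C (q : ℤ) := by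
      rw [← minpoly.isIntegrallyClosed_dvd_iff c.isIntegral_rep]
      simp [pow_two, c.rep_mul_self h]
    rw [finrank_field]
    exact (natDegree_le_of_dvd hdvd (X_pow_sub_C_ne_zero two_pos _)).trans_eq
      natDegree_X_pow_sub_C
  have h2 := c.finrank_field_pos
  have h3 := mt c.finrank_field_eq_one_iff.1 h'
  omega

theorem even_finrank_field (hq : 0 < q) (h : ¬ c.IsRational) :
    Even (Module.finrank ℚ c.field) := by
  by_cases him : c.rep.im = 0
  · rw [c.finrank_field_of_im_eq_zero him h]
    exact even_two
  · rw [finrank_field]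
    exact (even_natDegree_minpoly c.isIntegral_rep him hq c.rep_mul_conj).1

open Classical in
/-- The polynomial `h_π ∈ ℤ[F, V]` of a non-rational class `π`. -/
noncomputable def factor : MvPolynomial (Fin 2) ℤ :=
  if c.rep.im ≠ 0 then symmetrization c.minimalPolynomial else MvPolynomial.X 0 - MvPolynomial.X 1

theorem expand_factor (h : ¬ c.IsRational) :
    MvPolynomial.expand 2 c.factor = c.symmetricPolynomial := by
  unfold factor symmetricPolynomial
  have h' : c.rep ∉ Set.range (algebraMap ℚ ℂ) := h
  split_ifs <;> rfl

theorem isBalanced_factor (hq : 0 < q) (h : ¬ c.IsRational) {A : Type*} [CommRing A] (F V : A) :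
    IsBalanced F V (Module.finrank ℚ c.field / 2)
      (MvPolynomial.eval₂Hom (Int.castRingHom A) ![F, V] c.factor) := by
  unfold factor
  split_ifs with him
  · rw [finrank_field]
    exact isBalanced_symmetrization (minpoly.monic c.isIntegral_rep)
      (even_natDegree_minpoly c.isIntegral_rep him hq c.rep_mul_conj).1
      (minpoly.natDegree_pos c.isIntegral_rep)
  · rw [c.finrank_field_of_im_eq_zero (not_not.1 him) h]
    simpa using isBalanced_sub F V

theorem gen_sub_div_eq_zero (hq : 0 < q) (h : c.rep.im = 0) :
    c.gen - (q : c.field) / c.gen = 0 := by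
  rw [sub_eq_zero, eq_div_iff (c.gen_ne_zero hq)]
  refine (algebraMap c.field ℂ).injective ?_
  rw [map_mul, algebraMap_gen, c.rep_mul_self h, map_natCast]

theorem eval_factor_eq_zero (hq : 0 < q) :
    MvPolynomial.eval₂Hom (Int.castRingHom c.field) ![c.gen, (q : c.field) / c.gen] c.factor =
      0 := by
  unfold factor
  split_ifs with him
  · obtain ⟨d, hd⟩ := (even_natDegree_minpoly c.isIntegral_rep him hq c.rep_mul_conj).1
    exact eval_symmetrization_eq_zero hd
      (fun r hr => minpoly_coeff_sub c.isIntegral_rep him hq c.rep_mul_conj hd hr)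
      (c.gen_ne_zero hq) c.gen_mul_div ((c.aeval_gen_eq_zero_iff _).2 dvd_rfl)
  · simpa using c.gen_sub_div_eq_zero hq (not_not.1 him)

/-- Distinct classes have coprime minimal polynomials over `ℚ`. -/
theorem isCoprime_minpoly {c c' : WeilClass q} (h : c ≠ c') :
    IsCoprime (minpoly ℚ c.rep) (minpoly ℚ c'.rep) := by
  have hc : IsIntegral ℚ c.rep := c.isIntegral_rep.tower_top
  have hc' : IsIntegral ℚ c'.rep := c'.isIntegral_rep.tower_top
  refine (dvd_or_isCoprime _ _ (minpoly.irreducible hc)).resolve_left fun hdvd => h ?_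
  have heq : minpoly ℚ c.rep = minpoly ℚ c'.rep :=
    eq_of_monic_of_associated (minpoly.monic hc) (minpoly.monic hc')
      ((minpoly.irreducible hc).associated_of_dvd (minpoly.irreducible hc') hdvd)
  -- both fields are `ℚ[x]/(P)` for the common minimal polynomial `P`
  let e₁ : AdjoinRoot (minpoly ℚ c.rep) ≃+* ℚ⟮c.rep⟯ :=
    (IntermediateField.adjoinRootEquivAdjoin ℚ hc).toRingEquiv
  let e₂ : AdjoinRoot (minpoly ℚ c'.rep) ≃+* ℚ⟮c'.rep⟯ :=
    (IntermediateField.adjoinRootEquivAdjoin ℚ hc').toRingEquiv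
  let e₃ : AdjoinRoot (minpoly ℚ c.rep) ≃+* AdjoinRoot (minpoly ℚ c'.rep) :=
    (AdjoinRoot.algEquivOfEq ℚ _ _ heq).toRingEquiv
  have h₁ : e₁ (AdjoinRoot.root _) = IntermediateField.AdjoinSimple.gen ℚ c.rep :=
    IntermediateField.adjoinRootEquivAdjoin_apply_root ℚ hc
  have h₂ : e₂ (AdjoinRoot.root _) = IntermediateField.AdjoinSimple.gen ℚ c'.rep :=
    IntermediateField.adjoinRootEquivAdjoin_apply_root ℚ hc'
  have h₃ : e₃ (AdjoinRoot.root _) = AdjoinRoot.root _ := AdjoinRoot.algEquivOfEq_root _ _ heq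
  have hconj : (weilSetoid q).r (Quotient.out c) (Quotient.out c') := by
    refine ⟨(e₁.symm.trans e₃).trans e₂, ?_⟩
    change e₂ (e₃ (e₁.symm (IntermediateField.AdjoinSimple.gen ℚ c.rep))) =
      IntermediateField.AdjoinSimple.gen ℚ c'.rep
    rw [← h₁, e₁.symm_apply_apply, h₃, h₂]
  exact (Quotient.out_eq c).symm.trans ((Quotient.sound hconj).trans (Quotient.out_eq c'))

end WeilClass

open Polynomial in
/-- A polynomial of degree less than `deg w` that vanishes at all `π ∈ w` is zero. -/
theorem eq_zero_of_aeval_gen_eq_zero {q : ℕ} (w : Finset (WeilClass q)) {p : ℤ[X]}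
    (hdeg : p.degree < weilDegree w) (hp : ∀ c ∈ w, aeval c.gen p = 0) : p = 0 := by
  have hinj : Function.Injective (algebraMap ℤ ℚ) := Int.cast_injective
  have hmonic : ∀ c ∈ w, (minpoly ℚ c.rep).Monic := fun c _ =>
    minpoly.monic (c.isIntegral_rep.tower_top (A := ℚ))
  have hdvd : ∏ c ∈ w, minpoly ℚ c.rep ∣ p.map (algebraMap ℤ ℚ) := by
    refine Finset.prod_dvd_of_coprime (fun c _ c' _ h => WeilClass.isCoprime_minpoly h)
      fun c hc => ?_
    rw [minpoly.isIntegrallyClosed_eq_field_fractions' ℚ c.isIntegral_rep]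
    exact Polynomial.map_dvd _ ((c.aeval_gen_eq_zero_iff p).1 (hp c hc))
  have hprod : (∏ c ∈ w, minpoly ℚ c.rep).natDegree = weilDegree w := by
    rw [natDegree_prod_of_monic _ _ hmonic, weilDegree]
    exact Finset.sum_congr rfl fun c _ =>
      (IntermediateField.adjoin.finrank (c.isIntegral_rep.tower_top (A := ℚ))).symm
  refine (Polynomial.map_eq_zero_iff hinj).1 (eq_zero_of_dvd_of_degree_lt hdvd ?_)
  rw [degree_eq_natDegree (monic_prod_of_monic _ _ hmonic).ne_zero, hprod,
    degree_map_eq_of_injective hinj]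
  exact hdeg

/-! ### The polynomial `h_w` -/

open Classical in
/-- Among the two rational Weil numbers `±√q`, a set of even degree contains both or neither. -/
theorem rational_classes {q : ℕ} (w : Finset (WeilClass q)) (hq : 0 < q)
    (hw : Even (weilDegree w)) :
    w.filter WeilClass.IsRational = ∅ ∨
      ∃ c c' : WeilClass q, c ≠ c' ∧ w.filter WeilClass.IsRational = {c, c'} ∧
        c.rep = -c'.rep := by
  have hneg : ∀ c c' : WeilClass q, c.IsRational → c'.IsRational → c ≠ c' → c.rep = -c'.rep := by
    intro c c' h h' hne
    have h1 := c.rep_mul_self (WeilClass.im_rep_of_isRational h)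
    have h2 := c'.rep_mul_self (WeilClass.im_rep_of_isRational h')
    have h3 : (c.rep - c'.rep) * (c.rep + c'.rep) = 0 := by linear_combination h1 - h2
    rcases mul_eq_zero.1 h3 with h | h
    · exact absurd (WeilClass.rep_injective (sub_eq_zero.1 h)) hne
    · exact eq_neg_of_add_eq_zero_left h
  have hcard : Even (w.filter WeilClass.IsRational).card := by
    rw [weilDegree, ← Finset.sum_filter_add_sum_filter_not w WeilClass.IsRational,
      Nat.even_add] at hw
    have h1 : ∑ c ∈ w with c.IsRational, Module.finrank ℚ c.field =
        (w.filter WeilClass.IsRational).card := by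
      rw [Finset.card_eq_sum_ones]
      exact Finset.sum_congr rfl fun c hc =>
        c.finrank_field_eq_one_iff.2 (Finset.mem_filter.1 hc).2
    rw [← h1]
    exact hw.2 (even_iff_two_dvd.2 (Finset.dvd_sum fun c hc =>
      (c.even_finrank_field hq (Finset.mem_filter.1 hc).2).two_dvd))
  rcases Finset.eq_empty_or_nonempty (w.filter WeilClass.IsRational) with h | ⟨c, hc⟩
  · exact Or.inl h
  · obtain ⟨c', hc', hne⟩ : ∃ c' ∈ w.filter WeilClass.IsRational, c' ≠ c := by
      by_contra! h
      rw [Finset.eq_singleton_iff_unique_mem.2 ⟨hc, h⟩, Finset.card_singleton] at hcard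
      exact absurd hcard (by decide)
    have hr := (Finset.mem_filter.1 hc).2
    have hr' := (Finset.mem_filter.1 hc').2
    refine Or.inr ⟨c, c', hne.symm, ?_, hneg c c' hr hr' hne.symm⟩
    refine Finset.Subset.antisymm (fun d hd => ?_) ?_
    · by_contra hd'
      rw [Finset.mem_insert, Finset.mem_singleton, not_or] at hd'
      have hrd := (Finset.mem_filter.1 hd).2
      have h1 := hneg d c hrd hr hd'.1
      have h2 := hneg d c' hrd hr' hd'.2
      exact hne (WeilClass.rep_injective (neg_injective (h2.symm.trans h1)))
    · rintro d hd
      rcases Finset.mem_insert.1 hd with rfl | hd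
      · exact hc
      · rwa [Finset.mem_singleton.1 hd]

theorem symmetricPolynomial_mul_of_rep_eq_neg {q : ℕ} (hq : 0 < q) {c c' : WeilClass q}
    (h : c.IsRational) (h' : c'.IsRational) (hneg : c.rep = -c'.rep) :
    c.symmetricPolynomial * c'.symmetricPolynomial =
      MvPolynomial.expand 2 (MvPolynomial.X 0 - MvPolynomial.X 1) := by
  have him := WeilClass.im_rep_of_isRational h
  have him' := WeilClass.im_rep_of_isRational h'
  have hre : c'.rep.re ≠ 0 := fun h0 => c'.rep_ne_zero hq (Complex.ext h0 him')
  have hre' : c.rep.re = -c'.rep.re := by rw [hneg, Complex.neg_re]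
  unfold WeilClass.IsRational at h h'
  unfold WeilClass.symmetricPolynomial
  rw [if_neg (not_not.2 him), if_neg (not_not.2 h), if_neg (not_not.2 him'),
    if_neg (not_not.2 h'), map_sub, MvPolynomial.expand_X, MvPolynomial.expand_X, hre']
  rcases lt_or_gt_of_ne hre with hlt | hlt
  · rw [if_pos (by linarith), if_neg (by linarith)]
    ring
  · rw [if_neg (by linarith), if_pos (by linarith)]
    ring

/-- The polynomial `h` takes balanced values of width `D` at all pairs `F`, `V` with `FV = q` in
rings. -/
def IsBalancedPolynomial (q D : ℕ) (h : MvPolynomial (Fin 2) ℤ) : Prop :=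
  ∀ (A : Type) [CommRing A] (F V : A), F * V = q →
    IsBalanced F V D (MvPolynomial.eval₂Hom (Int.castRingHom A) ![F, V] h)

theorem polyToProd_apply {q : ℕ} (w : Finset (WeilClass q)) (f : MvPolynomial (Fin 2) ℤ)
    (c : w) : polyToProd w f c = MvPolynomial.eval₂Hom (Int.castRingHom c.1.field)
      ![c.1.gen, (q : c.1.field) / c.1.gen] f := by
  have h : (Pi.evalRingHom (fun c : w => c.1.field) c).comp (polyToProd w) =
      MvPolynomial.eval₂Hom (Int.castRingHom c.1.field)
        ![c.1.gen, (q : c.1.field) / c.1.gen] := by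
    refine MvPolynomial.ringHom_ext (fun r => by simp) fun i => ?_
    fin_cases i <;> simp [polyToProd]
  exact RingHom.congr_fun h f

open Classical in
/-- The polynomial `h_w` lies in `ℤ[F, V]`, is balanced of width `deg(w) / 2`, and vanishes at the
Weil numbers in `w`. -/
theorem exists_expand_eq_symmetricPolynomial {q : ℕ} (w : Finset (WeilClass q)) (hq : 0 < q)
    (hw : Even (weilDegree w)) :
    ∃ (h : MvPolynomial (Fin 2) ℤ) (D : ℕ), MvPolynomial.expand 2 h = symmetricPolynomial w ∧
      weilDegree w = D + D ∧ polyToProd w h = 0 ∧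
      IsBalancedPolynomial q D h := by
  set s := w.filter fun c => ¬ c.IsRational with hs
  have hs' : ∀ c ∈ s, ¬ c.IsRational := fun c hc => (Finset.mem_filter.1 hc).2
  have hexp : MvPolynomial.expand 2 (∏ c ∈ s, c.factor) = ∏ c ∈ s, c.symmetricPolynomial := by
    rw [map_prod]
    exact Finset.prod_congr rfl fun c hc => c.expand_factor (hs' c hc)
  have hdeg : ∑ c ∈ s, Module.finrank ℚ c.field =
      ∑ c ∈ s, Module.finrank ℚ c.field / 2 + ∑ c ∈ s, Module.finrank ℚ c.field / 2 := by
    rw [← Finset.sum_add_distrib]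
    refine Finset.sum_congr rfl fun c hc => ?_
    obtain ⟨d, hd⟩ := c.even_finrank_field hq (hs' c hc)
    omega
  have hbal : IsBalancedPolynomial q (∑ c ∈ s, Module.finrank ℚ c.field / 2)
      (∏ c ∈ s, c.factor) := by
    intro A _ F V hFV
    rw [map_prod]
    exact isBalanced_prod hFV s _ _ fun c hc => c.isBalanced_factor hq (hs' c hc) F V
  have hzero : ∀ c ∈ s, MvPolynomial.eval₂Hom (Int.castRingHom c.field)
      ![c.gen, (q : c.field) / c.gen] (∏ c ∈ s, c.factor) = 0 := fun c hc => by
    rw [map_prod]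
    exact Finset.prod_eq_zero hc (c.eval_factor_eq_zero hq)
  have hprod := Finset.prod_filter_mul_prod_filter_not w WeilClass.IsRational
    fun c => c.symmetricPolynomial
  have hsum := Finset.sum_filter_add_sum_filter_not w WeilClass.IsRational
    fun c => Module.finrank ℚ c.field
  rcases rational_classes w hq hw with hr | ⟨c, c', hne, hr, hneg⟩
  · rw [hr, Finset.prod_empty, one_mul] at hprod
    rw [hr, Finset.sum_empty, zero_add] at hsum
    refine ⟨_, _, hexp.trans hprod, hsum.symm.trans hdeg, funext fun c => ?_, hbal⟩
    have hc : ¬ c.1.IsRational := fun h => by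
      have : c.1 ∈ w.filter WeilClass.IsRational := Finset.mem_filter.2 ⟨c.2, h⟩
      rw [hr] at this
      exact absurd this (Finset.notMem_empty _)
    rw [polyToProd_apply]
    exact hzero c.1 (Finset.mem_filter.2 ⟨c.2, hc⟩)
  · have hc : c.IsRational := (Finset.mem_filter.1 (hr ▸ Finset.mem_insert_self c {c'})).2
    have hc' : c'.IsRational := (Finset.mem_filter.1
      (hr ▸ Finset.mem_insert_of_mem (Finset.mem_singleton_self c'))).2
    rw [hr, Finset.prod_pair hne, symmetricPolynomial_mul_of_rep_eq_neg hq hc hc' hneg] at hprod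
    rw [hr, Finset.sum_pair hne, c.finrank_field_eq_one_iff.2 hc,
      c'.finrank_field_eq_one_iff.2 hc'] at hsum
    refine ⟨(MvPolynomial.X 0 - MvPolynomial.X 1) * ∏ c ∈ s, c.factor,
      1 + ∑ c ∈ s, Module.finrank ℚ c.field / 2, ?_, ?_, funext fun d => ?_, ?_⟩
    · rw [map_mul, hexp]
      exact hprod
    · rw [weilDegree, ← hsum, ← hs, hdeg]
      ring
    · rw [polyToProd_apply, map_mul]
      by_cases hd : d.1.IsRational
      · have h0 := d.1.gen_sub_div_eq_zero hq (WeilClass.im_rep_of_isRational hd)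
        simp [h0]
      · rw [hzero d.1 (Finset.mem_filter.2 ⟨d.2, hd⟩), mul_zero]
        rfl
    · intro A _ F V hFV
      rw [map_mul]
      refine IsBalanced.mul hFV ?_ (hbal A F V hFV)
      simpa using isBalanced_sub F V

/-! ### The presentation of the minimal central order -/

theorem adjoin_eq_top_of_surjective {A : Type*} [CommRing A] (f : MvPolynomial (Fin 2) ℤ →+* A)
    (hf : Function.Surjective f) :
    Algebra.adjoin ℤ {f (MvPolynomial.X 0), f (MvPolynomial.X 1)} = ⊤ := by
  rw [eq_top_iff]
  rintro x -
  obtain ⟨p, rfl⟩ := hf x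
  induction p using MvPolynomial.induction_on with
  | C a =>
    rw [show f (MvPolynomial.C a) = algebraMap ℤ A a by simp]
    exact Subalgebra.algebraMap_mem _ a
  | add p p' hp hp' => rw [map_add]; exact add_mem hp hp'
  | mul_X p i hp =>
    rw [map_mul]
    refine mul_mem hp (Algebra.subset_adjoin ?_)
    fin_cases i <;> simp

theorem eval₂Hom_eq_of_ringHom {A : Type*} [CommRing A] (f : MvPolynomial (Fin 2) ℤ →+* A) :
    MvPolynomial.eval₂Hom (Int.castRingHom A) ![f (MvPolynomial.X 0), f (MvPolynomial.X 1)] =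
      f := by
  refine MvPolynomial.ringHom_ext (fun r => by simp) fun i => ?_
  fin_cases i <;> simp

/-- If `f : ℤ[F, V] → A` kills `FV - q` and a balanced element, then the powers `F^i` and `V^j`
span its image. -/
theorem span_powerFamily_eq_top_of_surjective {A : Type} [CommRing A] {q D : ℕ}
    (f : MvPolynomial (Fin 2) ℤ →+* A) (hf : Function.Surjective f) (hrel : f (relFV q) = 0)
    {h : MvPolynomial (Fin 2) ℤ} (h0 : f h = 0)
    (hbal : IsBalancedPolynomial q D h) :
    f (MvPolynomial.X 0) * f (MvPolynomial.X 1) = q ∧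
    IsBalanced (f (MvPolynomial.X 0)) (f (MvPolynomial.X 1)) D 0 ∧
    Submodule.span ℤ (Set.range
      (powerFamily (f (MvPolynomial.X 0)) (f (MvPolynomial.X 1)) D)) = ⊤ := by
  have hFV : f (MvPolynomial.X 0) * f (MvPolynomial.X 1) = q := by
    rw [relFV, map_sub, map_mul, sub_eq_zero] at hrel
    rw [hrel]
    simp
  have hb := hbal A (f (MvPolynomial.X 0)) (f (MvPolynomial.X 1)) hFV
  rw [eval₂Hom_eq_of_ringHom, h0] at hb
  exact ⟨hFV, hb, span_powerFamily_eq_top hFV (adjoin_eq_top_of_surjective f hf) hb⟩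

/-- The ring `ℤ[F, V]/(FV - q, h)` is spanned by the powers `F^i` and `V^j`; if these have linearly
independent images in `A`, then it embeds into `A`. -/
theorem ker_eq_span_of_linearIndependent {A : Type} [CommRing A] {q D : ℕ}
    (f : MvPolynomial (Fin 2) ℤ →+* A) (hrel : f (relFV q) = 0)
    {h : MvPolynomial (Fin 2) ℤ} (h0 : f h = 0) (hbal : IsBalancedPolynomial q D h)
    (hli : LinearIndependent ℤ
      (powerFamily (f (MvPolynomial.X 0)) (f (MvPolynomial.X 1)) D)) :
    RingHom.ker f = Ideal.span {relFV q, h} := by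
  set I := Ideal.span {relFV q, h} with hI
  have hle : I ≤ RingHom.ker f := by
    rw [hI, Ideal.span_le]
    rintro x (rfl | rfl)
    · exact hrel
    · exact h0
  refine le_antisymm (fun g hg => ?_) hle
  have hspan := (span_powerFamily_eq_top_of_surjective (Ideal.Quotient.mk I)
    Ideal.Quotient.mk_surjective
    (Ideal.Quotient.eq_zero_iff_mem.2 (Ideal.subset_span (Or.inl rfl)))
    (Ideal.Quotient.eq_zero_iff_mem.2 (Ideal.subset_span (Or.inr rfl))) hbal).2.2
  let α : (MvPolynomial (Fin 2) ℤ ⧸ I) →+* A := Ideal.Quotient.lift I f fun a ha => hle ha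
  obtain ⟨v, hv⟩ := (Submodule.mem_span_range_iff_exists_fun ℤ).1
    (hspan ▸ Submodule.mem_top : Ideal.Quotient.mk I g ∈ _)
  have h1 : ∑ i, v i • powerFamily (f (MvPolynomial.X 0)) (f (MvPolynomial.X 1)) D i = 0 := by
    have h2 : α (Ideal.Quotient.mk I g) = 0 := hg
    rw [← hv, map_sum] at h2
    rw [← h2]
    refine Finset.sum_congr rfl fun i _ => ?_
    rw [map_zsmul, map_powerFamily]
    rfl
  have h3 := Fintype.linearIndependent_iff.1 hli v h1
  rw [← Ideal.Quotient.eq_zero_iff_mem, ← hv]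
  exact Finset.sum_eq_zero fun i _ => by rw [h3 i, zero_smul]

/-! ### Rings finite over the integers -/

theorem ringKrullDim_eq_one_of_finite_int (R : Type*) [CommRing R] [Module.Finite ℤ R]
    [FaithfulSMul ℤ R] : ringKrullDim R = 1 := by
  have hZ : ringKrullDim ℤ = 1 :=
    IsPrincipalIdealRing.ringKrullDim_eq_one ℤ Int.not_isField
  refine le_antisymm ?_ ?_
  · rw [← hZ]
    refine Order.krullDim_le_of_strictMono (PrimeSpectrum.comap (algebraMap ℤ R)) fun P Q h => ?_
    exact Ideal.IsIntegral.comap_lt_comap h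
  · have hker : RingHom.ker (algebraMap ℤ R) = ⊥ :=
      (RingHom.injective_iff_ker_eq_bot _).1 (FaithfulSMul.algebraMap_injective ℤ R)
    obtain ⟨Q, -, hQ, hQ0⟩ := Ideal.exists_ideal_over_prime_of_isIntegral (⊥ : Ideal ℤ)
      (⊥ : Ideal R) hker.le
    have h2 : (Ideal.span {(2 : ℤ)}).IsPrime :=
      (Ideal.span_singleton_prime two_ne_zero).2 Int.prime_two
    obtain ⟨Q', hle, hQ', hQ2⟩ := Ideal.exists_ideal_over_prime_of_isIntegral
      (Ideal.span {(2 : ℤ)}) Q (hQ0.trans_le bot_le)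
    have hlt : (⟨Q, hQ⟩ : PrimeSpectrum R) < ⟨Q', hQ'⟩ := by
      refine lt_of_le_of_ne hle fun h => ?_
      have h3 : Q = Q' := congrArg PrimeSpectrum.asIdeal h
      rw [h3, hQ2, Ideal.span_singleton_eq_bot] at hQ0
      exact two_ne_zero hQ0
    exact Order.one_le_krullDim_iff.2 ⟨_, _, hlt⟩

/-- A generating family with no more members than the rank is linearly independent. -/
theorem linearIndependent_of_card_le_finrank {ι M : Type*} [Fintype ι] [AddCommGroup M] {v : ι → M}
    (hv : Submodule.span ℤ (Set.range v) = ⊤) (h : Fintype.card ι ≤ Module.finrank ℤ M) :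
    LinearIndependent ℤ v := by
  let g : (ι → ℤ) →ₗ[ℤ] M := Fintype.linearCombination ℤ v
  have hg : LinearMap.range g = ⊤ := by rw [Fintype.range_linearCombination, hv]
  have h1 := (LinearMap.ker g).finrank_quotient_add_finrank
  rw [g.quotKerEquivRange.finrank_eq, hg, finrank_top, Module.finrank_fintype_fun_eq_card] at h1
  have h2 : LinearMap.ker g = ⊥ := Submodule.finrank_eq_zero.1 (by omega)
  exact Fintype.linearIndependent_iff.2 fun v hv' =>
    congrFun (LinearMap.ker_eq_bot'.1 h2 v hv')

/-! ### Quotients by the kernel of the map to the product -/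

section Order

variable {q : ℕ} {w : Finset (WeilClass q)} {A : Type} [CommRing A]
  {f : MvPolynomial (Fin 2) ℤ →+* A}

open Polynomial in
/-- The powers `F^i` with `i < deg(w)` are linearly independent in `ℤ[F, V]/ker`. -/
theorem weilDegree_le_finrank [Module.Finite ℤ A] (hker : ∀ p, f p = 0 ↔ polyToProd w p = 0) :
    weilDegree w ≤ Module.finrank ℤ A := by
  let g : degreeLT ℤ (weilDegree w) →ₗ[ℤ] A :=
    (aeval (f (MvPolynomial.X 0))).toLinearMap.comp (degreeLT ℤ (weilDegree w)).subtype
  have hg : Function.Injective g := by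
    rw [injective_iff_map_eq_zero]
    rintro ⟨p, hp⟩ h
    refine Subtype.ext (eq_zero_of_aeval_gen_eq_zero w (mem_degreeLT.1 hp) fun c hc => ?_)
    have h1 : aeval (f (MvPolynomial.X 0)) p = f (aeval (MvPolynomial.X 0) p) :=
      aeval_algHom_apply f.toIntAlgHom _ p
    have h2 := congrFun ((hker _).1 (h1.symm.trans h)) ⟨c, hc⟩
    rw [polyToProd_apply] at h2
    have h3 := aeval_algHom_apply (MvPolynomial.eval₂Hom (Int.castRingHom c.field)
      ![c.gen, (q : c.field) / c.gen]).toIntAlgHom (MvPolynomial.X 0) p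
    have h4 : (MvPolynomial.eval₂Hom (Int.castRingHom c.field)
      ![c.gen, (q : c.field) / c.gen]).toIntAlgHom (MvPolynomial.X 0) = c.gen := by simp
    rw [h4] at h3
    exact h3.trans h2
  have h := LinearMap.finrank_le_finrank_of_injective hg
  rwa [(degreeLTEquiv ℤ (weilDegree w)).finrank_eq, Module.finrank_fin_fun] at h

theorem linearIndependent_powerFamily (hf : Function.Surjective f)
    (hker : ∀ p, f p = 0 ↔ polyToProd w p = 0) {D : ℕ} {h : MvPolynomial (Fin 2) ℤ}
    (hD : weilDegree w = D + D) (hzero : polyToProd w h = 0) (hbal : IsBalancedPolynomial q D h) :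
    LinearIndependent ℤ (powerFamily (f (MvPolynomial.X 0)) (f (MvPolynomial.X 1)) D) := by
  have hspan := (span_powerFamily_eq_top_of_surjective f hf
    ((hker _).2 (polyToProd_relFV w)) ((hker _).2 hzero) hbal).2.2
  have : Module.Finite ℤ A := ⟨hspan ▸ Submodule.fg_span (Set.finite_range _)⟩
  refine linearIndependent_of_card_le_finrank hspan ?_
  rw [Fintype.card_sum, Fintype.card_fin, ← hD]
  exact weilDegree_le_finrank hker

theorem ringKrullDim_eq_one_and_isGorensteinRing (hf : Function.Surjective f)
    (hker : ∀ p, f p = 0 ↔ polyToProd w p = 0) {D : ℕ} {h : MvPolynomial (Fin 2) ℤ} (hD0 : 0 < D)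
    (hD : weilDegree w = D + D) (hzero : polyToProd w h = 0) (hbal : IsBalancedPolynomial q D h) :
    ringKrullDim A = 1 ∧ IsGorensteinRing A := by
  obtain ⟨hFV, hb0, hspan⟩ := span_powerFamily_eq_top_of_surjective f hf
    ((hker _).2 (polyToProd_relFV w)) ((hker _).2 hzero) hbal
  let b := Module.Basis.mk (linearIndependent_powerFamily hf hker hD hzero hbal) hspan.ge
  have hb : ∀ i, b i = powerFamily _ _ D i := fun i => Module.Basis.mk_apply _ _ i
  have : Module.Free ℤ A := Module.Free.of_basis b
  have : Module.Finite ℤ A := Module.Finite.of_basis b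
  have : Nontrivial A := by
    by_contra hA
    rw [not_nontrivial_iff_subsingleton] at hA
    exact b.ne_zero (Sum.inl ⟨0, hD0⟩) (Subsingleton.elim _ _)
  exact ⟨ringKrullDim_eq_one_of_finite_int A, isGorensteinRing_of_isBalanced_zero hFV hD0 hb0 b hb⟩

end Order

/-! ### Complete intersections -/

theorem prime_relFV {q : ℕ} (hq : 0 < q) : Prime (relFV q) := by
  have hq' : (q : ℤ) ≠ 0 := by exact_mod_cast hq.ne'
  have h : Irreducible ((MvPolynomial.X 0 : MvPolynomial (Fin 2) ℤ) * MvPolynomial.X 1 +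
      MvPolynomial.C (-(q : ℤ))) := by
    refine MvPolynomial.irreducible_mul_X_add _ _ 1 (MvPolynomial.X_ne_zero 0) (by simp)
      (by rw [MvPolynomial.vars_C]; exact Finset.notMem_empty _) ?_
    have hX : Irreducible (MvPolynomial.X 0 : MvPolynomial (Fin 2) ℤ) :=
      (MvPolynomial.X_prime).irreducible
    refine (hX.isRelPrime_iff_not_dvd).2 fun hdvd => ?_
    have h0 := map_dvd (MvPolynomial.eval (0 : Fin 2 → ℤ)) hdvd
    simp only [MvPolynomial.eval_X, MvPolynomial.eval_C, Pi.zero_apply, zero_dvd_iff,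
      neg_eq_zero] at h0
    exact hq' h0
  rw [map_neg, ← sub_eq_add_neg] at h
  exact h.prime

/-- The ring `ℤ[F, V]/(FV - q)` is not finite over `ℤ`, because it maps to `ℚ` by `F ↦ 1/2`,
`V ↦ 2q`. -/
theorem not_finite_FVRing (q : ℕ) : ¬ Module.Finite ℤ (FVRing q) := by
  intro hfin
  let e : MvPolynomial (Fin 2) ℤ →+* ℚ :=
    MvPolynomial.eval₂Hom (Int.castRingHom ℚ) ![1 / 2, 2 * q]
  let f : FVRing q →+* ℚ := Ideal.Quotient.lift _ e fun a ha => by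
    have h : Ideal.span {relFV q} ≤ RingHom.ker e := by
      rw [Ideal.span_le, Set.singleton_subset_iff]
      simp [e, relFV, RingHom.mem_ker]
    exact h ha
  have h1 : IsIntegral ℤ (Ideal.Quotient.mk (Ideal.span {relFV q}) (MvPolynomial.X 0)) :=
    Algebra.IsIntegral.isIntegral _
  have h2 := h1.map f.toIntAlgHom
  have h3 : f.toIntAlgHom (Ideal.Quotient.mk (Ideal.span {relFV q}) (MvPolynomial.X 0)) =
      1 / 2 := by
    change e (MvPolynomial.X 0) = 1 / 2
    simp [e]
  rw [h3] at h2
  obtain ⟨y, hy⟩ := IsIntegrallyClosed.isIntegral_iff.1 h2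
  have h4 : (2 * y : ℤ) = 1 := by
    have : (y : ℚ) = 1 / 2 := hy
    have h5 : (2 * y : ℚ) = 1 := by rw [this]; norm_num
    exact_mod_cast h5
  omega

theorem not_relFV_dvd {q D : ℕ} {h : MvPolynomial (Fin 2) ℤ}
    (hbal : IsBalancedPolynomial q D h) :
    ¬ relFV q ∣ h := fun hdvd => by
  have hspan := (span_powerFamily_eq_top_of_surjective
    (Ideal.Quotient.mk (Ideal.span {relFV q})) Ideal.Quotient.mk_surjective
    (Ideal.Quotient.eq_zero_iff_mem.2 (Ideal.mem_span_singleton_self _))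
    (Ideal.Quotient.eq_zero_iff_mem.2 (Ideal.mem_span_singleton.2 hdvd)) hbal).2.2
  exact not_finite_FVRing q ⟨hspan ▸ Submodule.fg_span (Set.finite_range _)⟩

theorem isRegular_pair {S : Type*} [CommRing S] [IsDomain S] {a b : S} (ha : Prime a)
    (hb : ¬ a ∣ b) (htop : Ideal.span {a, b} ≠ ⊤) : RingTheory.Sequence.IsRegular S [a, b] := by
  have hlist : Ideal.ofList [a, b] = Ideal.span {a, b} := by
    rw [Ideal.ofList_cons, Ideal.ofList_singleton, ← Ideal.span_insert]
  refine ⟨?_, ?_⟩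
  · rw [RingTheory.Sequence.isWeaklyRegular_cons_iff,
      RingTheory.Sequence.isWeaklyRegular_singleton_iff]
    refine ⟨fun x y hxy => mul_left_cancel₀ ha.ne_zero hxy, ?_⟩
    refine (isSMulRegular_quotient_iff_mem_of_smul_mem _ _).2 fun x hx => ?_
    obtain ⟨y, -, hy⟩ := (Submodule.mem_smul_pointwise_iff_exists _ _ _).1 hx
    obtain ⟨z, rfl⟩ := (ha.dvd_or_dvd ⟨y, hy.symm⟩).resolve_left hb
    exact (Submodule.mem_smul_pointwise_iff_exists _ _ _).2 ⟨z, Submodule.mem_top, rfl⟩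
  · rw [hlist, smul_eq_mul, Ideal.mul_top]
    exact htop.symm

/-- The structure of `R_w`, for any ring `A` that is the quotient of `ℤ[F, V]` by the kernel of the
map to `∏ ℚ(π)`. -/
theorem presentation_of_ker_eq_ker_polyToProd {q : ℕ} (hq : 0 < q) {w : Finset (WeilClass q)}
    (hw : Even (weilDegree w)) {A : Type} [CommRing A] {f : MvPolynomial (Fin 2) ℤ →+* A}
    (hf : Function.Surjective f) (hkerf : ∀ p, f p = 0 ↔ polyToProd w p = 0) :
    (∃ h : MvPolynomial (Fin 2) ℤ,
      MvPolynomial.expand 2 h = symmetricPolynomial w ∧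
      ∃ φ : A ≃+* (MvPolynomial (Fin 2) ℤ ⧸ Ideal.span {relFV q, h}),
        ∀ p, φ (f p) = Ideal.Quotient.mk (Ideal.span {relFV q, h}) p) ∧
    (w.Nonempty →
      ringKrullDim A = 1 ∧ IsCompleteIntersectionRing A ∧ IsGorensteinRing A) := by
  obtain ⟨h, D, hexp, hD, hzero, hbal⟩ := exists_expand_eq_symmetricPolynomial w hq hw
  have hker : RingHom.ker f = Ideal.span {relFV q, h} :=
    ker_eq_span_of_linearIndependent _ ((hkerf _).2 (polyToProd_relFV w)) ((hkerf _).2 hzero) hbal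
      (linearIndependent_powerFamily hf hkerf hD hzero hbal)
  let ψ := (Ideal.quotEquivOfEq hker.symm).trans (RingHom.quotientKerEquivOfSurjective hf)
  have hψ : ∀ p, ψ (Ideal.Quotient.mk _ p) = f p := fun p => rfl
  refine ⟨⟨h, hexp, ψ.symm, fun p => by rw [← hψ, RingEquiv.symm_apply_apply]⟩, fun hne => ?_⟩
  have hD0 : 0 < D := by
    have : 0 < weilDegree w := Finset.sum_pos (fun c _ => c.finrank_field_pos) hne
    omega
  obtain ⟨hdim, hgor⟩ := ringKrullDim_eq_one_and_isGorensteinRing hf hkerf hD0 hD hzero hbal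
  refine ⟨hdim, ?_, hgor⟩
  have htop : Ideal.span {relFV q, h} ≠ ⊤ := fun htop => by
    rw [← hker, Ideal.eq_top_iff_one, RingHom.mem_ker, hkerf] at htop
    obtain ⟨c, hc⟩ := hne
    have h1 := congrFun htop ⟨c, hc⟩
    rw [map_one] at h1
    exact one_ne_zero h1
  refine ⟨MvPolynomial (Fin 2) ℤ, inferInstance, inferInstance, [relFV q, h],
    isRegular_pair (prime_relFV hq) (not_relFV_dvd hbal) htop, ⟨ψ.symm.trans ?_⟩⟩
  exact Ideal.quotEquivOfEq (by
    rw [Ideal.ofList_cons, Ideal.ofList_singleton, ← Ideal.span_insert])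

theorem mainTheorem3 (q : ℕ) (hq : IsPrimePow q) (w : Finset (WeilClass q))
    (hw : Even (weilDegree w)) :
    (∃ h : MvPolynomial (Fin 2) ℤ,
      MvPolynomial.expand 2 h = symmetricPolynomial w ∧
      ∃ φ : MinimalCentralOrder w ≃+* (MvPolynomial (Fin 2) ℤ ⧸ Ideal.span {relFV q, h}),
        ∀ f : MvPolynomial (Fin 2) ℤ,
          φ (toMinimalCentralOrder w f) = Ideal.Quotient.mk (Ideal.span {relFV q, h}) f) ∧
    (w.Nonempty →
      ringKrullDim (MinimalCentralOrder w) = 1 ∧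
      IsCompleteIntersectionRing (MinimalCentralOrder w) ∧
      IsGorensteinRing (MinimalCentralOrder w)) := by
  have hsurj : Function.Surjective (toMinimalCentralOrder w) :=
    Ideal.Quotient.mk_surjective.comp Ideal.Quotient.mk_surjective
  refine presentation_of_ker_eq_ker_polyToProd hq.pos hw (A := MinimalCentralOrder w)
    (f := toMinimalCentralOrder w) hsurj fun p => ?_
  rw [toMinimalCentralOrder, RingHom.comp_apply, Ideal.Quotient.eq_zero_iff_mem, RingHom.mem_ker]
  rfl
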